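/- Write $\langle s\rangle=\sqrt{1+s^2}$ and $\hat w(\xi,\eta)=\iint_{\mathbb R^2}e^{-i(\xi x+\eta y)}w(x,y)\,dx\,dy$ (extended to $L^2$ by Plancherel). Consider the linearized $\beta$-plane equation near the Couette flow on $\mathbb R^2$, $$\partial_t\omega+y\,\partial_x\omega-\partial_x\Delta^{-1}\omega=0,\qquad \omega(0,x,y)=\omega_0(x,y),\qquad t\ge 0,$$ with $\omega_0\in L^2(\mathbb R^2)$. For the profile $f(t,z,y)=\omega(t,z+ty,y)$, where $z=x-ty$, the equation reads, frequency by frequency, $$\partial_t\hat f(t,\xi,\eta)=-\frac{i\xi}{\xi^2+(\eta-t\xi)^2}\,\hat f(t,\xi,\eta),\qquad \hat f(0,\cdot)=\hat\omega_0,$$ and a solution is a function $\omega(t,\cdot)\in L^2$, $t\ge0$, for which this holds for almost every $(\xi,\eta)$ and all $t\ge 0$. Let $\psi=-\Delta^{-1}\omega$ be the stream function and $\phi(t,z,y)=\psi(t,z+ty,y)$ its profile, so that $$\phi_z(t,z,y)=\frac1{(2\pi)^2}\iint_{\mathbb R^2}e^{i(\xi z+\eta y)}\frac{i\xi\,\hat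 f(t,\xi,\eta)}{\xi^2+(\eta-t\xi)^2}\,d\xi d\eta,\qquad \phi_y(t,z,y)=\frac1{(2\pi)^2}\iint_{\mathbb R^2}e^{i(\xi z+\eta y)}\frac{i\eta\,\hat f(t,\xi,\eta)}{\xi^2+(\eta-t\xi)^2}\,d\xi d\eta ,$$ and let $u^x=\partial_y\psi$, $u^y=-\partial_x\psi$ be the velocity, i.e. the inverse Fourier integrals of $\frac{i\eta}{\xi^2+\eta^2}\hat\omega$ and $\frac{-i\xi}{\xi^2+\eta^2}\hat\omega$. Assume that $\hat\omega_0$ is locally Lipschitz and that $$C(\omega_0)=\|\langle (\xi,\eta)\rangle^{5}\hat\omega_0\|_{L^\infty}+\|\langle (\xi,\eta)\rangle^{6}\nabla_{\xi,\eta}\hat\omega_0\|_{L^\infty}<\infty ,\qquad \langle(\xi,\eta)\rangle=\sqrt{1+\xi^2+\eta^2}.$$ Then for all $t>0$ the four integrals above converge absolutely, and: (a) There is an absolute constant $C$ such that for all $t>0$ and all $(z,y)\neq(0,0)$, with $\rho=\sqrt{z^2+y^2}$, $$|\phi_z(t,z,y)|\le C\,C(\omega_0)\,\langle\rho\rangle\log(\rho+\rho^{-1}+1)\,\frac{\ln(t+2)}{\langle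 t\rangle^{3/2}},\qquad |\phi_y(t,z,y)|\le C\,C(\omega_0)\,\langle\rho\rangle\log(\rho+\rho^{-1}+1)\,\frac{\ln(t+2)}{\langle t\rangle}.$$ (b) For every $R>0$ there is a constant $C_R$, depending only on $R$, such that for all $t>0$ and all $(x,y)$ with $\frac1R\le|x-ty|+|y|\le R$, $$|u^x(t,x,y)|\le C_R\,C(\omega_0)\,\ln(t+2)\,\langle t\rangle^{-1/2},\qquad |u^y(t,x,y)|\le C_R\,C(\omega_0)\,\ln(t+2)\,\langle t\rangle^{-3/2}.$$ -/

import Mathlib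

open MeasureTheory
open scoped FourierTransform ENNReal

noncomputable section

/-- The plane `ℝ²` with its Euclidean norm. A point is `(x, y)`, `(z, y)` or, on the Fourier side,
`(ξ, η)`; the two coordinates are `p 0` and `p 1`. -/
abbrev Plane : Type := EuclideanSpace ℝ (Fin 2)

/-- The Japanese bracket `⟨s⟩ = √(1 + s²)`. -/
def japaneseBracket (s : ℝ) : ℝ := Real.sqrt (1 + s ^ 2)

/-- The Fourier transform `ŵ(k) = ∫ e^{-i k·p} w(p) dp` of `w ∈ L²(ℝ²)` (Plancherel extension).
Mathlib's transform has the kernel `e^{-2πi k·p}`, which accounts for the factor `(2π)⁻¹`. -/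
def planeFourier (w : Plane → ℂ) : Plane → ℂ := by
  classical
  exact fun k =>
    if h : MemLp w 2 (volume : Measure Plane) then
      (𝓕 (h.toLp w) : Lp ℂ 2 (volume : Measure Plane)) ((2 * Real.pi)⁻¹ • k)
    else 0

/-- The inverse Fourier integral `(2π)⁻² ∫ e^{i k·p} G(k) dk`. -/
def planeFourierInvIntegral (G : Plane → ℂ) (p : Plane) : ℂ :=
  (((2 * Real.pi) ^ 2)⁻¹ : ℝ) *
    ∫ k : Plane, Complex.exp (Complex.I * ((k 0 * p 0 + k 1 * p 1 : ℝ) : ℂ)) * G k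

/-- The profile in the coordinates moving with the Couette flow, `z = x - t y`:
`f(t, z, y) = ω(t, z + t y, y)`. -/
def vorticityProfile (ω : ℝ → Plane → ℂ) (t : ℝ) (p : Plane) : ℂ :=
  ω t !₂[p 0 + t * p 1, p 1]

/-- The symbol `ξ² + (η - t ξ)²` of `-Δ` in the moving coordinates. -/
def shearedSymbol (t : ℝ) (k : Plane) : ℝ := (k 0) ^ 2 + (k 1 - t * k 0) ^ 2

/-- `ω` is a (finite energy) solution for times `t ≥ 0` of the linearized `β`-plane equation
`∂_t ω + y ∂_x ω - ∂_x Δ⁻¹ ω = 0`, `ω(0) = ω₀`.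
The nonlocal operator `∂_x Δ⁻¹` is the Fourier multiplier `-iξ / (ξ² + η²)`. In the moving
coordinates the equation is `∂_t f = ∂_z (∂_z² + (∂_y - t ∂_z)²)⁻¹ f`, which on the Fourier side
is `∂_t f̂ = -iξ / (ξ² + (η - tξ)²) f̂`, required for almost every frequency and all times. -/
structure IsBetaPlaneSolution (ω₀ : Plane → ℂ) (ω : ℝ → Plane → ℂ) : Prop where
  memLp : ∀ t : ℝ, 0 ≤ t → MemLp (ω t) 2 (volume : Measure Plane)
  memLp_profile : ∀ t : ℝ, 0 ≤ t → MemLp (vorticityProfile ω t) 2 (volume : Measure Plane)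
  initial : ω 0 =ᵐ[volume] ω₀
  evolution : ∃ F : ℝ → Plane → ℂ,
    (∀ t : ℝ, 0 ≤ t → F t =ᵐ[volume] planeFourier (vorticityProfile ω t)) ∧
    ∀ᵐ k : Plane, ∀ t : ℝ, 0 ≤ t →
      HasDerivWithinAt (fun s => F s k)
        (-(Complex.I * (k 0 : ℂ) / (shearedSymbol t k : ℂ)) * F t k) (Set.Ici 0) t

/-- The Fourier transform `iξ / (ξ² + (η - tξ)²) f̂(t, ξ, η)` of `∂_z φ`, where
`φ(t, z, y) = ψ(t, z + t y, y)` is the profile of the stream function `ψ = -Δ⁻¹ ω`. -/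
def phiZHat (ω : ℝ → Plane → ℂ) (t : ℝ) (k : Plane) : ℂ :=
  Complex.I * (k 0 : ℂ) / (shearedSymbol t k : ℂ) * planeFourier (vorticityProfile ω t) k

/-- The Fourier transform `iη / (ξ² + (η - tξ)²) f̂(t, ξ, η)` of `∂_y φ`. -/
def phiYHat (ω : ℝ → Plane → ℂ) (t : ℝ) (k : Plane) : ℂ :=
  Complex.I * (k 1 : ℂ) / (shearedSymbol t k : ℂ) * planeFourier (vorticityProfile ω t) k

/-- `φ_z(t, z, y)`. -/
def phiZ (ω : ℝ → Plane → ℂ) (t : ℝ) (p : Plane) : ℂ := planeFourierInvIntegral (phiZHat ω t) p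

/-- `φ_y(t, z, y)`. -/
def phiY (ω : ℝ → Plane → ℂ) (t : ℝ) (p : Plane) : ℂ := planeFourierInvIntegral (phiYHat ω t) p

/-- The Fourier transform `iη / (ξ² + η²) ω̂` of the first velocity component `u^x = ∂_y ψ`. -/
def velXHat (ω : ℝ → Plane → ℂ) (t : ℝ) (k : Plane) : ℂ :=
  Complex.I * (k 1 : ℂ) / (((k 0) ^ 2 + (k 1) ^ 2 : ℝ) : ℂ) * planeFourier (ω t) k

/-- The Fourier transform `-iξ / (ξ² + η²) ω̂` of the second velocity component `u^y = -∂_x ψ`,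
so that `∂_x u^y - ∂_y u^x = ω`. -/
def velYHat (ω : ℝ → Plane → ℂ) (t : ℝ) (k : Plane) : ℂ :=
  -(Complex.I * (k 0 : ℂ)) / (((k 0) ^ 2 + (k 1) ^ 2 : ℝ) : ℂ) * planeFourier (ω t) k

/-- The velocity component `u^x(t, x, y)`, by the Biot–Savart law. -/
def velX (ω : ℝ → Plane → ℂ) (t : ℝ) (p : Plane) : ℂ := planeFourierInvIntegral (velXHat ω t) p

/-- The velocity component `u^y(t, x, y)`, by the Biot–Savart law. -/
def velY (ω : ℝ → Plane → ℂ) (t : ℝ) (p : Plane) : ℂ := planeFourierInvIntegral (velYHat ω t) p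

/-- `‖⟨ξ,η⟩⁵ g‖_{L^∞} + ‖⟨ξ,η⟩⁶ ∇g‖_{L^∞}`, with values in `[0, ∞]`, for `g` the Fourier transform
of the initial vorticity. -/
def dataNorm (g : Plane → ℂ) : ℝ≥0∞ :=
  eLpNorm (fun k : Plane => japaneseBracket ‖k‖ ^ 5 * ‖g k‖) ⊤ volume +
    eLpNorm (fun k : Plane => japaneseBracket ‖k‖ ^ 6 * ‖fderiv ℝ g k‖) ⊤ volume

end

open Filter Topology Set

namespace BetaPlane

noncomputable section

/-! ### Locally Lipschitz functions -/

/-! The equation is solved frequency by frequency by an integrating factor: `f̂ = e^{-iΦ} ω̂₀` with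
`Φ = ξ⁻¹(arctan(t - η/ξ) + arctan(η/ξ))`. The symbol `S = 1/(ξ² + (η - tξ)²)` reaches the size `ξ⁻²`
on the critical line `η = tξ`, so decay in time cannot be read off from absolute values there. The
phase supplies it: `∂_η Φ = 1/(ξ² + η²) - S`, hence `i S e^{-iΦ} = ∂_η e^{-iΦ} + i (ξ² + η²)⁻¹
e^{-iΦ}`, and the singular part is a total derivative in `η`.

This identity is used only near the critical line, through the rational weight `W = 4t²ξ²η²K²`,
where `K = 1/(η² + t²ξ²)`. Since `1 - W = (η² - t²ξ²)²K²` vanishes to second order at `η = tξ`, `(1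
- W)S ≤ 2K` (`abs_one_sub_weight_mul_le`); the factor `η²` gives `W/(ξ² + η²) ≤ 4K`
(`weight_mul_inv_le`), and `|∂_η W| ≤ 8|η|K`. Integrating by parts on each line `ξ = const`
therefore replaces `S` by the nonresonant kernel `K`, at the cost of one derivative of `ω̂₀` and a
factor `1 + |y|` (`norm_integral_lineIntegrand_le`).

It remains to integrate absolute values. By Young's inequality `|ξ|K ≤ t^{-3/2}|ξη|^{-1/2}`, which
gives the rate of `φ_z`; `|η|K` is a Poisson kernel in `ξ` of mass `π/t`, which gives the rate of
`φ_y`. For `t ≤ 1` a direct bound suffices. The logarithms in the statement enter only as factors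
bounded below by `1/2`. The velocity follows from `u^x = φ_y - tφ_z` and `u^y = -φ_z` at `(x - ty,
y)`, once the `L²` Fourier transform is known to intertwine shears. -/

theorem locallyLipschitz_mul {f g : ℝ → ℂ} (hf : LocallyLipschitz f) (hg : LocallyLipschitz g) :
    LocallyLipschitz (fun x => f x * g x) := by
  have h : ContDiff ℝ 1 (fun p : ℂ × ℂ => p.1 * p.2) := contDiff_fst.mul contDiff_snd
  exact h.locallyLipschitz.comp (hf.prodMk hg)

theorem intervalIntegral_deriv_eq_sub_of_locallyLipschitz {f : ℝ → ℝ} (hf : LocallyLipschitz f)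
    (a b : ℝ) : ∫ x in a..b, deriv f x = f b - f a := by
  obtain ⟨K, hK⟩ := (hf.locallyLipschitzOn (s := uIcc a b)).exists_lipschitzOnWith_of_compact
    isCompact_uIcc
  exact hK.absolutelyContinuousOnInterval.integral_deriv_eq_sub

theorem integral_deriv_eq_zero_of_locallyLipschitz {f : ℝ → ℝ} (hf : LocallyLipschitz f)
    (hint : Integrable (deriv f)) (hbot : Tendsto f atBot (𝓝 0)) (htop : Tendsto f atTop (𝓝 0)) :
    ∫ x, deriv f x = 0 := by
  have h1 : Tendsto (fun n : ℝ => ∫ x in (-n)..n, deriv f x) atTop (𝓝 (∫ x, deriv f x)) :=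
    intervalIntegral_tendsto_integral hint tendsto_neg_atTop_atBot tendsto_id
  have h2 : Tendsto (fun n : ℝ => ∫ x in (-n)..n, deriv f x) atTop (𝓝 (0 - 0)) := by
    simp_rw [intervalIntegral_deriv_eq_sub_of_locallyLipschitz hf]
    exact htop.sub (hbot.comp tendsto_neg_atTop_atBot)
  simpa using tendsto_nhds_unique h1 h2

/-- The vanishing of boundary terms in the integration by parts. Locally Lipschitz functions are
absolutely continuous on compact intervals, so an almost everywhere derivative suffices; real-linear
functionals reduce the complex case to the real one. -/
theorem integral_eq_zero_of_ae_hasDerivAt {f f' : ℝ → ℂ} (hf : LocallyLipschitz f)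
    (hd : ∀ᵐ x, HasDerivAt f (f' x) x)
    (hint : Integrable f') (hbot : Tendsto f atBot (𝓝 0)) (htop : Tendsto f atTop (𝓝 0)) :
    ∫ x, f' x = 0 := by
  have key : ∀ L : ℂ →L[ℝ] ℝ, L (∫ x, f' x) = 0 := by
    intro L
    have hae : deriv (fun x => L (f x)) =ᵐ[volume] fun x => L (f' x) := by
      filter_upwards [hd] with x hx
      exact (L.hasFDerivAt.comp_hasDerivAt x hx).deriv
    have hL0 : Tendsto (fun z : ℂ => L z) (𝓝 0) (𝓝 0) := by
      simpa using L.continuous.tendsto 0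
    rw [← L.integral_comp_comm hint, ← integral_congr_ae hae]
    exact integral_deriv_eq_zero_of_locallyLipschitz
      (L.lipschitz.locallyLipschitz.comp hf)
      ((integrable_congr hae).2 (L.integrable_comp hint))
      (hL0.comp hbot) (hL0.comp htop)
  exact Complex.ext (key Complex.reCLM) (key Complex.imCLM)

/-- Rademacher's theorem for locally Lipschitz functions. -/
theorem ae_differentiableAt_of_locallyLipschitz {g : Plane → ℂ} (hg : LocallyLipschitz g) :
    ∀ᵐ k : Plane, DifferentiableAt ℝ g k := by
  have h : ∀ n : ℕ, ∀ᵐ k : Plane, k ∈ Metric.closedBall (0 : Plane) n →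
      DifferentiableWithinAt ℝ g (Metric.closedBall (0 : Plane) n) k := by
    intro n
    obtain ⟨K, hK⟩ := (hg.locallyLipschitzOn
      (s := Metric.closedBall (0 : Plane) n)).exists_lipschitzOnWith_of_compact
      (isCompact_closedBall _ _)
    exact hK.ae_differentiableWithinAt_of_mem
  filter_upwards [ae_all_iff.2 h] with k hk
  obtain ⟨n, hn⟩ := exists_nat_gt ‖k‖
  exact (hk n (by simpa using hn.le)).differentiableAt
    (Metric.closedBall_mem_nhds_of_mem (by simpa using hn))

/-! ### The oscillatory phase -/

/-- The kernel `1 / (η² + t² ξ²)`. -/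
def kernel (t ξ η : ℝ) : ℝ := (η ^ 2 + t ^ 2 * ξ ^ 2)⁻¹

/-- A weight which equals `1` on the critical line `η = t ξ`. -/
def weight (t ξ η : ℝ) : ℝ := 4 * t ^ 2 * ξ ^ 2 * (η ^ 2 * kernel t ξ η ^ 2)

/-- The inverse `1 / (ξ² + (η - t ξ)²)` of the sheared symbol. -/
def invSymbol (t ξ η : ℝ) : ℝ := (ξ ^ 2 + (η - t * ξ) ^ 2)⁻¹

/-- The phase `Φ` of the solution, `f̂ = e^{-iΦ} ω̂₀`. -/
def phase (t ξ η : ℝ) : ℝ := ξ⁻¹ * (Real.arctan (t - η / ξ) + Real.arctan (η / ξ))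

/-- The bracket `⟨(ξ, η)⟩`. -/
def bracket (ξ η : ℝ) : ℝ := Real.sqrt (1 + ξ ^ 2 + η ^ 2)

theorem phase_zero (ξ η : ℝ) : phase 0 ξ η = 0 := by simp [phase, Real.arctan_neg]

theorem hasDerivAt_phase_time {ξ : ℝ} (hξ : ξ ≠ 0) (t η : ℝ) :
    HasDerivAt (fun s => phase s ξ η) (ξ * invSymbol t ξ η) t := by
  have h := ((((hasDerivAt_id t).sub_const (η / ξ)).arctan).add_const
    (Real.arctan (η / ξ))).const_mul ξ⁻¹
  refine h.congr_deriv ?_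
  have h1 : ξ ^ 2 + (η - t * ξ) ^ 2 ≠ 0 := by positivity
  have h2 : (1 + (t - η / ξ) ^ 2) = (ξ ^ 2 + (η - t * ξ) ^ 2) / ξ ^ 2 := by
    field_simp; ring
  simp only [invSymbol, id, h2]
  field_simp

/-- The identity behind the proof: up to the milder term `(ξ² + η²)⁻¹`, the singular symbol is `-∂_η
Φ`. -/
theorem hasDerivAt_phase {ξ : ℝ} (hξ : ξ ≠ 0) (t η : ℝ) :
    HasDerivAt (fun s => phase t ξ s) ((ξ ^ 2 + η ^ 2)⁻¹ - invSymbol t ξ η) η := by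
  have h0 : HasDerivAt (fun s : ℝ => s / ξ) (1 / ξ) η := (hasDerivAt_id η).div_const ξ
  have h := (((h0.const_sub t).arctan).add h0.arctan).const_mul ξ⁻¹
  refine h.congr_deriv ?_
  have h1 : ξ ^ 2 + (η - t * ξ) ^ 2 ≠ 0 := by positivity
  have h3 : ξ ^ 2 + η ^ 2 ≠ 0 := by positivity
  have h2 : (1 + (t - η / ξ) ^ 2) = (ξ ^ 2 + (η - t * ξ) ^ 2) / ξ ^ 2 := by
    field_simp; ring
  have h4 : (1 + (η / ξ) ^ 2) = (ξ ^ 2 + η ^ 2) / ξ ^ 2 := by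
    field_simp
  simp only [invSymbol, h2, h4]
  field_simp
  ring

theorem contDiff_phase (t ξ : ℝ) : ContDiff ℝ 1 (fun s => phase t ξ s) := by
  exact contDiff_const.mul (ContDiff.add (ContDiff.arctan (by fun_prop))
    (ContDiff.arctan (by fun_prop)))

theorem continuous_bracket (ξ : ℝ) : Continuous (bracket ξ) := by
  unfold bracket; fun_prop

/-! ### Kernel bounds -/

theorem kernel_nonneg (t ξ η : ℝ) : 0 ≤ kernel t ξ η := by unfold kernel; positivity

theorem invSymbol_nonneg (t ξ η : ℝ) : 0 ≤ invSymbol t ξ η := by unfold invSymbol; positivity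

theorem weight_nonneg (t ξ η : ℝ) : 0 ≤ weight t ξ η := by unfold weight; positivity

theorem sq_mul_kernel_le (t ξ η : ℝ) : η ^ 2 * kernel t ξ η ≤ 1 := by
  unfold kernel
  rw [← div_eq_mul_inv]
  exact div_le_one_of_le₀ (by nlinarith [sq_nonneg (t * ξ)]) (by positivity)

theorem time_sq_mul_kernel_le (t ξ η : ℝ) : t ^ 2 * ξ ^ 2 * kernel t ξ η ≤ 1 := by
  unfold kernel
  rw [← div_eq_mul_inv]
  exact div_le_one_of_le₀ (by nlinarith [sq_nonneg η]) (by positivity)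

theorem weight_le (t ξ η : ℝ) : weight t ξ η ≤ 4 * η ^ 2 * kernel t ξ η := by
  have h := time_sq_mul_kernel_le t ξ η
  have h2 : 0 ≤ η ^ 2 * kernel t ξ η := mul_nonneg (sq_nonneg _) (kernel_nonneg _ _ _)
  unfold weight
  nlinarith

/-- The factor `η²` in the weight absorbs `(ξ² + η²)⁻¹`, and `t²ξ²` absorbs one of the two kernels.
-/
theorem weight_mul_inv_le (t ξ η : ℝ) :
    weight t ξ η * (ξ ^ 2 + η ^ 2)⁻¹ ≤ 4 * kernel t ξ η := by
  have h := time_sq_mul_kernel_le t ξ η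
  have hk := kernel_nonneg t ξ η
  have h1 : η ^ 2 * (ξ ^ 2 + η ^ 2)⁻¹ ≤ 1 := by
    rw [← div_eq_mul_inv]
    exact div_le_one_of_le₀ (by nlinarith [sq_nonneg ξ]) (by positivity)
  have h0 : 0 ≤ η ^ 2 * (ξ ^ 2 + η ^ 2)⁻¹ := by positivity
  calc weight t ξ η * (ξ ^ 2 + η ^ 2)⁻¹
      = 4 * kernel t ξ η * ((t ^ 2 * ξ ^ 2 * kernel t ξ η) * (η ^ 2 * (ξ ^ 2 + η ^ 2)⁻¹)) := by
        unfold weight; ring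
    _ ≤ 4 * kernel t ξ η * 1 := by
        gcongr
        exact mul_le_one₀ h h0 h1
    _ = _ := mul_one _

/-- The factor `(η - tξ)²` of `1 - W` cancels the symbol, and the remaining factor satisfies `(η +
tξ)² ≤ 2(η² + t²ξ²)`. -/
theorem abs_one_sub_weight_mul_le {t ξ : ℝ} (ht : 0 < t) (hξ : ξ ≠ 0) (η : ℝ) :
    |(1 - weight t ξ η) * invSymbol t ξ η| ≤ 2 * kernel t ξ η := by
  have hpos : 0 < η ^ 2 + t ^ 2 * ξ ^ 2 := by positivity
  have hs : 0 < ξ ^ 2 + (η - t * ξ) ^ 2 := by positivity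
  have e : (1 - weight t ξ η) * invSymbol t ξ η =
      (((η - t * ξ) ^ 2 * (η + t * ξ) ^ 2) / (η ^ 2 + t ^ 2 * ξ ^ 2) ^ 2) /
        (ξ ^ 2 + (η - t * ξ) ^ 2) := by
    unfold weight kernel invSymbol
    field_simp
    ring
  have h1 : ((η - t * ξ) ^ 2 * (η + t * ξ) ^ 2) ≤
      (2 * (η ^ 2 + t ^ 2 * ξ ^ 2)) * (ξ ^ 2 + (η - t * ξ) ^ 2) := by
    rw [mul_comm]
    apply mul_le_mul _ _ (sq_nonneg _) (by positivity)
    · nlinarith [sq_nonneg (η - t * ξ)]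
    · nlinarith [sq_nonneg ξ]
  rw [e, abs_of_nonneg (by positivity), kernel, div_div, div_le_iff₀ (by positivity)]
  refine h1.trans (le_of_eq ?_)
  field_simp

/-- The derivative of `weight t ξ`. -/
def weightDeriv (t ξ η : ℝ) : ℝ :=
  8 * t ^ 2 * ξ ^ 2 * (η * kernel t ξ η ^ 2 * (1 - 2 * (η ^ 2 * kernel t ξ η)))

theorem hasDerivAt_weight {t ξ : ℝ} (ht : 0 < t) (hξ : ξ ≠ 0) (η : ℝ) :
    HasDerivAt (weight t ξ) (weightDeriv t ξ η) η := by
  have hpos : η ^ 2 + t ^ 2 * ξ ^ 2 ≠ 0 := by positivity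
  have h2 : HasDerivAt (fun s : ℝ => s ^ 2) (2 * η) η := by simpa using hasDerivAt_pow 2 η
  have hk : HasDerivAt (kernel t ξ) (-(2 * η) / (η ^ 2 + t ^ 2 * ξ ^ 2) ^ 2) η :=
    (h2.add_const (t ^ 2 * ξ ^ 2)).inv hpos
  have h := (h2.mul (hk.pow 2)).const_mul (4 * t ^ 2 * ξ ^ 2)
  refine h.congr_deriv ?_
  simp only [weightDeriv, kernel, Pi.pow_apply, Nat.cast_ofNat, Nat.add_one_sub_one, pow_one]
  field_simp
  ring

theorem abs_weightDeriv_le (t ξ η : ℝ) : |weightDeriv t ξ η| ≤ 8 * |η| * kernel t ξ η := by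
  have h := time_sq_mul_kernel_le t ξ η
  have hk := kernel_nonneg t ξ η
  have h0 : 0 ≤ t ^ 2 * ξ ^ 2 * kernel t ξ η := by positivity
  have h1 := sq_mul_kernel_le t ξ η
  have h2 : 0 ≤ η ^ 2 * kernel t ξ η := by positivity
  have h3 : |1 - 2 * (η ^ 2 * kernel t ξ η)| ≤ 1 := abs_le.2 ⟨by linarith, by linarith⟩
  calc |weightDeriv t ξ η|
      = 8 * |η| * kernel t ξ η * ((t ^ 2 * ξ ^ 2 * kernel t ξ η) *
          |1 - 2 * (η ^ 2 * kernel t ξ η)|) := by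
        have : weightDeriv t ξ η = η * ((8 * kernel t ξ η * (t ^ 2 * ξ ^ 2 * kernel t ξ η)) *
            (1 - 2 * (η ^ 2 * kernel t ξ η))) := by unfold weightDeriv; ring
        rw [this, abs_mul, abs_mul, abs_of_nonneg (by positivity :
          0 ≤ 8 * kernel t ξ η * (t ^ 2 * ξ ^ 2 * kernel t ξ η))]
        ring
    _ ≤ 8 * |η| * kernel t ξ η * 1 := by
        gcongr
        exact mul_le_one₀ h (abs_nonneg _) h3
    _ = _ := mul_one _

theorem contDiff_weight {t ξ : ℝ} (ht : 0 < t) (hξ : ξ ≠ 0) : ContDiff ℝ 1 (weight t ξ) := by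
  unfold weight kernel
  have : ∀ η : ℝ, η ^ 2 + t ^ 2 * ξ ^ 2 ≠ 0 := fun η => by positivity
  fun_prop (disch := assumption)

theorem one_le_bracket (ξ η : ℝ) : 1 ≤ bracket ξ η :=
  Real.one_le_sqrt.2 (by nlinarith [sq_nonneg ξ, sq_nonneg η])

theorem bracket_sq (ξ η : ℝ) : bracket ξ η ^ 2 = 1 + ξ ^ 2 + η ^ 2 :=
  Real.sq_sqrt (by positivity)

theorem abs_le_bracket (ξ η : ℝ) : |η| ≤ bracket ξ η :=
  Real.abs_le_sqrt (by nlinarith [sq_nonneg ξ])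

/-! ### Integration by parts along a line `ξ = const` -/

theorem inv_bracket_sq_le (ξ η : ℝ) : (bracket ξ η ^ 2)⁻¹ ≤ (1 + η ^ 2)⁻¹ := by
  rw [bracket_sq]
  exact inv_anti₀ (by positivity) (by nlinarith [sq_nonneg ξ])

theorem integrable_inv_bracket_sq (ξ : ℝ) : Integrable fun η => (bracket ξ η ^ 2)⁻¹ := by
  refine integrable_inv_one_add_sq.mono' ?_ (ae_of_all _ fun η => ?_)
  · have := continuous_bracket ξ
    exact ((this.pow 2).measurable.inv).aestronglyMeasurable
  · rw [Real.norm_of_nonneg (by positivity)]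
    exact inv_bracket_sq_le ξ η

theorem kernel_le {t ξ : ℝ} (ht : 0 < t) (hξ : ξ ≠ 0) (η : ℝ) :
    kernel t ξ η ≤ (t ^ 2 * ξ ^ 2)⁻¹ :=
  inv_anti₀ (by positivity) (by nlinarith [sq_nonneg η])

theorem invSymbol_le {ξ : ℝ} (hξ : ξ ≠ 0) (t η : ℝ) : invSymbol t ξ η ≤ (ξ ^ 2)⁻¹ :=
  inv_anti₀ (by positivity) (by nlinarith [sq_nonneg (η - t * ξ)])

theorem continuous_kernel {t ξ : ℝ} (ht : 0 < t) (hξ : ξ ≠ 0) : Continuous (kernel t ξ) := by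
  have : ∀ η : ℝ, η ^ 2 + t ^ 2 * ξ ^ 2 ≠ 0 := fun η => by positivity
  unfold kernel
  fun_prop (disch := assumption)

theorem continuous_invSymbol {ξ : ℝ} (hξ : ξ ≠ 0) (t : ℝ) : Continuous (invSymbol t ξ) := by
  have : ∀ η : ℝ, ξ ^ 2 + (η - t * ξ) ^ 2 ≠ 0 := fun η => by positivity
  unfold invSymbol
  fun_prop (disch := assumption)

theorem norm_exp_I_mul (s : ℝ) : ‖Complex.exp (Complex.I * (s : ℂ))‖ = 1 := by
  rw [mul_comm]; exact Complex.norm_exp_ofReal_mul_I s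

theorem norm_exp_neg_I_mul (s : ℝ) : ‖Complex.exp (-(Complex.I * (s : ℂ)))‖ = 1 := by
  have := norm_exp_I_mul (-s)
  rwa [Complex.ofReal_neg, mul_neg] at this

theorem norm_mul_exp_neg_I_mul (z : ℂ) (s : ℝ) :
    ‖z * Complex.exp (-(Complex.I * (s : ℂ)))‖ = ‖z‖ := by
  rw [norm_mul, norm_exp_neg_I_mul, mul_one]

theorem integrable_mul_kernel_line {t ξ c : ℝ} (ht : 0 < t) (hξ : ξ ≠ 0) {m : ℝ → ℝ}
    (hm : Continuous m) (hmc : ∀ η, |m η| ≤ c * bracket ξ η) :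
    Integrable fun η => |m η| * kernel t ξ η * (bracket ξ η ^ 3)⁻¹ := by
  refine (((integrable_inv_bracket_sq ξ).const_mul (c * (t ^ 2 * ξ ^ 2)⁻¹))).mono' ?_
    (ae_of_all _ fun η => ?_)
  · exact (((hm.abs.mul (continuous_kernel ht hξ)).measurable).mul
      ((continuous_bracket ξ).pow 3).measurable.inv).aestronglyMeasurable
  · have hk := kernel_nonneg t ξ η
    have hr : 0 < bracket ξ η := lt_of_lt_of_le one_pos (one_le_bracket ξ η)
    rw [Real.norm_of_nonneg (by positivity)]
    have hc : 0 ≤ c * bracket ξ η := (abs_nonneg _).trans (hmc η)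
    calc |m η| * kernel t ξ η * (bracket ξ η ^ 3)⁻¹
        ≤ (c * bracket ξ η) * (t ^ 2 * ξ ^ 2)⁻¹ * (bracket ξ η ^ 3)⁻¹ := by
          gcongr
          · exact hmc η
          · exact kernel_le ht hξ η
      _ = c * (t ^ 2 * ξ ^ 2)⁻¹ * (bracket ξ η ^ 2)⁻¹ := by field_simp

/-- The amplitude to which the integration by parts in `η` is applied. -/
def amplitude (t ξ y : ℝ) (m : ℝ → ℝ) (h : ℝ → ℂ) (η : ℝ) : ℂ :=
  Complex.exp (Complex.I * ((y * η : ℝ) : ℂ)) * ((m η * weight t ξ η : ℝ) : ℂ) * h η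

/-- The derivative of `amplitude`. -/
def amplitudeDeriv (t ξ y : ℝ) (m m' : ℝ → ℝ) (h h' : ℝ → ℂ) (η : ℝ) : ℂ :=
  Complex.exp (Complex.I * ((y * η : ℝ) : ℂ)) *
    (Complex.I * (y : ℂ) * ((m η * weight t ξ η : ℝ) : ℂ) * h η +
      ((m' η * weight t ξ η + m η * weightDeriv t ξ η : ℝ) : ℂ) * h η +
      ((m η * weight t ξ η : ℝ) : ℂ) * h' η)

theorem hasDerivAt_exp_I (y η : ℝ) :
    HasDerivAt (fun s : ℝ => Complex.exp (Complex.I * ((y * s : ℝ) : ℂ)))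
      (Complex.exp (Complex.I * ((y * η : ℝ) : ℂ)) * (Complex.I * (y : ℂ))) η := by
  have h : HasDerivAt (fun s : ℝ => Complex.I * ((y * s : ℝ) : ℂ)) (Complex.I * (y : ℂ)) η := by
    have := (((hasDerivAt_id η).const_mul y).ofReal_comp).const_mul Complex.I
    simpa using this
  exact h.cexp

theorem hasDerivAt_exp_phase {ξ : ℝ} (hξ : ξ ≠ 0) (t η : ℝ) :
    HasDerivAt (fun s : ℝ => Complex.exp (-(Complex.I * (phase t ξ s : ℂ))))
      (Complex.exp (-(Complex.I * (phase t ξ η : ℂ))) *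
        -(Complex.I * (((ξ ^ 2 + η ^ 2)⁻¹ - invSymbol t ξ η : ℝ) : ℂ))) η :=
  (((hasDerivAt_phase hξ t η).ofReal_comp.const_mul Complex.I).neg).cexp

theorem hasDerivAt_amplitude {t ξ : ℝ} (ht : 0 < t) (hξ : ξ ≠ 0) (y : ℝ) {m m' : ℝ → ℝ}
    {h h' : ℝ → ℂ} {η : ℝ} (hm : HasDerivAt m (m' η) η) (hh : HasDerivAt h (h' η) η) :
    HasDerivAt (amplitude t ξ y m h) (amplitudeDeriv t ξ y m m' h h' η) η := by
  have h1 := ((hasDerivAt_exp_I y η).mul (hm.mul (hasDerivAt_weight ht hξ η)).ofReal_comp).mul hh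
  refine h1.congr_deriv ?_
  simp only [amplitudeDeriv, Pi.mul_apply]
  ring

/-- What is left of the integrand after subtracting the total derivative, with the unimodular factor
`e^{-iΦ}` removed. Every term carries `|m| K`; bounding `W` or `∂_η W` by the kernel costs up to two
powers of `η`, which the decay of the data pays for. -/
theorem norm_remainder_le {t ξ y M : ℝ} (ht : 0 < t) (hξ : ξ ≠ 0) {m m' : ℝ → ℝ}
    {h h' : ℝ → ℂ} {η : ℝ} (hmm : |η| * |m' η| ≤ |m η|) (hb : ‖h η‖ * bracket ξ η ^ 5 ≤ M)
    (hb' : ‖h' η‖ * bracket ξ η ^ 6 ≤ M) :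
    ‖Complex.I * (Complex.exp (Complex.I * ((y * η : ℝ) : ℂ)) *
          (((m η * (1 - weight t ξ η) * invSymbol t ξ η : ℝ) : ℂ) * h η)) +
        Complex.I * (((ξ ^ 2 + η ^ 2)⁻¹ : ℝ) : ℂ) * amplitude t ξ y m h η -
        amplitudeDeriv t ξ y m m' h h' η‖ ≤
      (22 + 4 * |y|) * M * (|m η| * kernel t ξ η * (bracket ξ η ^ 3)⁻¹) := by
  set r := bracket ξ η with hr
  set K := kernel t ξ η with hK
  set W := weight t ξ η with hW
  have hr1 : 1 ≤ r := one_le_bracket ξ η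
  have hr0 : 0 < r := by linarith
  have hη : |η| ≤ r := abs_le_bracket ξ η
  have hK0 : 0 ≤ K := kernel_nonneg _ _ _
  have hW0 : 0 ≤ W := weight_nonneg _ _ _
  have hWK : W ≤ 4 * η ^ 2 * K := weight_le t ξ η
  have e1 : ‖Complex.I * (Complex.exp (Complex.I * ((y * η : ℝ) : ℂ)) *
      (((m η * (1 - W) * invSymbol t ξ η : ℝ) : ℂ) * h η))‖ ≤ 2 * |m η| * K * ‖h η‖ := by
    rw [norm_mul, norm_mul, norm_mul, norm_exp_I_mul, Complex.norm_I, Complex.norm_real,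
      Real.norm_eq_abs, mul_assoc (m η), abs_mul, one_mul, one_mul]
    have := abs_one_sub_weight_mul_le ht hξ η
    calc |m η| * |(1 - W) * invSymbol t ξ η| * ‖h η‖ ≤ |m η| * (2 * K) * ‖h η‖ := by gcongr
      _ = _ := by ring
  have e2 : ‖Complex.I * (((ξ ^ 2 + η ^ 2)⁻¹ : ℝ) : ℂ) * amplitude t ξ y m h η‖ ≤
      4 * |m η| * K * ‖h η‖ := by
    rw [amplitude, norm_mul, norm_mul, norm_mul, norm_mul, norm_exp_I_mul, Complex.norm_I,
      Complex.norm_real, Complex.norm_real, Real.norm_eq_abs, Real.norm_eq_abs, abs_mul,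
      abs_of_nonneg hW0, abs_of_nonneg (by positivity : 0 ≤ (ξ ^ 2 + η ^ 2)⁻¹)]
    have := weight_mul_inv_le t ξ η
    calc 1 * (ξ ^ 2 + η ^ 2)⁻¹ * (1 * (|m η| * W) * ‖h η‖)
        = |m η| * (W * (ξ ^ 2 + η ^ 2)⁻¹) * ‖h η‖ := by ring
      _ ≤ |m η| * (4 * K) * ‖h η‖ := by gcongr
      _ = _ := by ring
  -- The hypothesis `|η m'| ≤ |m|` trades a derivative of the multiplier for a power of `η`, so this
  -- term is also proportional to `|m| K`.
  have hmW : |m' η| * W ≤ 4 * |η| * |m η| * K := by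
    calc |m' η| * W ≤ |m' η| * (4 * |η| ^ 2 * K) := by rw [sq_abs]; gcongr
      _ = 4 * |η| * (|η| * |m' η|) * K := by ring
      _ ≤ _ := by gcongr
  have hmW' : |m η| * |weightDeriv t ξ η| ≤ 8 * |η| * |m η| * K := by
    calc |m η| * |weightDeriv t ξ η| ≤ |m η| * (8 * |η| * K) := by
          gcongr; exact abs_weightDeriv_le t ξ η
      _ = _ := by ring
  have hmW'' : |m η| * W ≤ 4 * |η| ^ 2 * |m η| * K := by
    calc |m η| * W ≤ |m η| * (4 * η ^ 2 * K) := by gcongr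
      _ = _ := by rw [sq_abs]; ring
  have e3 : ‖amplitudeDeriv t ξ y m m' h h' η‖ ≤
      |m η| * K * ((4 * |y| * |η| ^ 2 + 12 * |η|) * ‖h η‖ + 4 * |η| ^ 2 * ‖h' η‖) := by
    rw [amplitudeDeriv, norm_mul, norm_exp_I_mul, one_mul]
    refine (norm_add₃_le).trans ?_
    rw [norm_mul, norm_mul, norm_mul, norm_mul, norm_mul, Complex.norm_I]
    simp only [Complex.norm_real, Real.norm_eq_abs, one_mul]
    have i1 : |m' η * W + m η * weightDeriv t ξ η| ≤ 12 * |η| * |m η| * K := by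
      refine (abs_add_le _ _).trans ?_
      rw [abs_mul, abs_mul, abs_of_nonneg hW0]
      linarith
    have i2 : |m η * W| ≤ 4 * |η| ^ 2 * |m η| * K := by
      rwa [abs_mul, abs_of_nonneg hW0]
    calc |y| * |m η * W| * ‖h η‖ + |m' η * W + m η * weightDeriv t ξ η| * ‖h η‖ +
          |m η * W| * ‖h' η‖
        ≤ |y| * (4 * |η| ^ 2 * |m η| * K) * ‖h η‖ + (12 * |η| * |m η| * K) * ‖h η‖ +
          (4 * |η| ^ 2 * |m η| * K) * ‖h' η‖ := by gcongr
      _ = _ := by ring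
  have b1 : ‖h η‖ ≤ M * (r ^ 5)⁻¹ := by
    rwa [← div_eq_mul_inv, le_div_iff₀ (by positivity)]
  have b2 : ‖h' η‖ ≤ M * (r ^ 6)⁻¹ := by
    rwa [← div_eq_mul_inv, le_div_iff₀ (by positivity)]
  have hM : 0 ≤ M := le_trans (by positivity) hb
  have n5 : 6 * (r ^ 5)⁻¹ ≤ 6 * (r ^ 3)⁻¹ := by
    gcongr
    norm_num
  have n4 : (r ^ 4)⁻¹ ≤ (r ^ 3)⁻¹ := by
    gcongr
    norm_num
  refine (norm_sub_le _ _).trans ((add_le_add ((norm_add_le _ _).trans (add_le_add e1 e2)) e3).trans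
    ?_)
  calc 2 * |m η| * K * ‖h η‖ + 4 * |m η| * K * ‖h η‖ +
        |m η| * K * ((4 * |y| * |η| ^ 2 + 12 * |η|) * ‖h η‖ + 4 * |η| ^ 2 * ‖h' η‖)
      = |m η| * K * ((6 + 4 * |y| * |η| ^ 2 + 12 * |η|) * ‖h η‖ + 4 * |η| ^ 2 * ‖h' η‖) := by ring
    _ ≤ |m η| * K * ((6 + 4 * |y| * r ^ 2 + 12 * r) * (M * (r ^ 5)⁻¹) +
          4 * r ^ 2 * (M * (r ^ 6)⁻¹)) := by gcongr
    -- The constant 22 is 6, from the two undifferentiated terms, plus 16 = 12 + 4, from the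
    -- derivatives of `m W` and of `h`. The term in `y`, from differentiating the character, decays
    -- slowest and fixes the power `r⁻³`.
    _ = |m η| * K * M * (6 * (r ^ 5)⁻¹ + 4 * |y| * (r ^ 3)⁻¹ + 16 * (r ^ 4)⁻¹) := by
        field_simp; ring
    _ ≤ |m η| * K * M * (6 * (r ^ 3)⁻¹ + 4 * |y| * (r ^ 3)⁻¹ + 16 * (r ^ 3)⁻¹) := by
        gcongr
    _ = _ := by ring

/-- The integrand of the oscillatory integral over a line `ξ = const`. -/
def lineIntegrand (t ξ y : ℝ) (m : ℝ → ℝ) (h : ℝ → ℂ) (η : ℝ) : ℂ :=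
  Complex.exp (Complex.I * ((y * η : ℝ) : ℂ)) * (((m η * invSymbol t ξ η : ℝ) : ℂ) *
    (Complex.exp (-(Complex.I * (phase t ξ η : ℂ))) * h η))

theorem norm_lineIntegrand (t ξ y : ℝ) (m : ℝ → ℝ) (h : ℝ → ℂ) (η : ℝ) :
    ‖lineIntegrand t ξ y m h η‖ = |m η| * invSymbol t ξ η * ‖h η‖ := by
  rw [lineIntegrand, norm_mul, norm_mul, norm_mul, norm_exp_I_mul, norm_exp_neg_I_mul,
    Complex.norm_real, Real.norm_eq_abs, abs_mul, abs_of_nonneg (invSymbol_nonneg t ξ η)]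
  ring

/-- Qualitative only: the factor `ξ⁻²` in the majorant is harmless because `ξ` is fixed. -/
theorem integrable_lineIntegrand {t ξ y c M : ℝ} (hξ : ξ ≠ 0) {m : ℝ → ℝ}
    (hm : Continuous m) (hmc : ∀ η, |m η| ≤ c * bracket ξ η) {h : ℝ → ℂ} (hh : Continuous h)
    (hb : ∀ η, ‖h η‖ * bracket ξ η ^ 5 ≤ M) : Integrable (lineIntegrand t ξ y m h) := by
  refine (((integrable_inv_bracket_sq ξ).const_mul (c * (ξ ^ 2)⁻¹ * M))).mono' ?_
    (ae_of_all _ fun η => ?_)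
  · have h1 := continuous_invSymbol hξ t
    have h2 := (contDiff_phase t ξ).continuous
    have : Continuous (lineIntegrand t ξ y m h) := by
      unfold lineIntegrand
      fun_prop
    exact this.aestronglyMeasurable
  · rw [norm_lineIntegrand]
    have hr1 := one_le_bracket ξ η
    have hr : 0 < bracket ξ η := lt_of_lt_of_le one_pos hr1
    have hM : 0 ≤ M := le_trans (by positivity) (hb η)
    have hc : 0 ≤ c := by
      have := (abs_nonneg _).trans (hmc η)
      exact nonneg_of_mul_nonneg_left this hr
    have b1 : ‖h η‖ ≤ M * (bracket ξ η ^ 5)⁻¹ := by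
      rw [← div_eq_mul_inv, le_div_iff₀ (by positivity)]; exact hb η
    have n4 : (bracket ξ η ^ 4)⁻¹ ≤ (bracket ξ η ^ 2)⁻¹ := by
      gcongr
      norm_num
    calc |m η| * invSymbol t ξ η * ‖h η‖
        ≤ (c * bracket ξ η) * (ξ ^ 2)⁻¹ * (M * (bracket ξ η ^ 5)⁻¹) := by
          have := invSymbol_nonneg t ξ η
          gcongr
          · exact hmc η
          · exact invSymbol_le hξ t η
      _ = c * (ξ ^ 2)⁻¹ * M * (bracket ξ η ^ 4)⁻¹ := by field_simp
      _ ≤ _ := by gcongr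

theorem tendsto_zero_of_norm_le_inv_one_add_sq {C : ℝ} {f : ℝ → ℂ}
    (hf : ∀ η, ‖f η‖ ≤ C * (1 + η ^ 2)⁻¹) : Tendsto f atBot (𝓝 0) ∧ Tendsto f atTop (𝓝 0) := by
  have hsq : Tendsto (fun η : ℝ => η ^ 2) atBot atTop := by
    have := (tendsto_pow_atTop (α := ℝ) two_ne_zero).comp tendsto_neg_atBot_atTop
    simpa [Function.comp_def] using this
  have hsq' : Tendsto (fun η : ℝ => η ^ 2) atTop atTop := tendsto_pow_atTop two_ne_zero
  have h : ∀ l : Filter ℝ, Tendsto (fun η : ℝ => η ^ 2) l atTop → Tendsto f l (𝓝 0) := by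
    intro l hl
    refine squeeze_zero_norm hf ?_
    simpa using ((tendsto_inv_atTop_zero.comp (tendsto_atTop_add_const_left l 1 hl)).const_mul C)
  exact ⟨h _ hsq, h _ hsq'⟩

/-- The integration by parts: `i` times the integrand differs from the derivative of `F` by the
remainder estimated above, and `F` vanishes at infinity. -/
theorem norm_integral_lineIntegrand_le {t ξ c M : ℝ} (ht : 0 < t) (hξ : ξ ≠ 0) (y : ℝ)
    {m m' : ℝ → ℝ} (hm1 : ContDiff ℝ 1 m) (hm : ∀ η, HasDerivAt m (m' η) η)
    (hmm : ∀ η, |η| * |m' η| ≤ |m η|) (hmc : ∀ η, |m η| ≤ c * bracket ξ η)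
    {h h' : ℝ → ℂ} (hh : LocallyLipschitz h) (hd : ∀ᵐ η, HasDerivAt h (h' η) η)
    (hb : ∀ η, ‖h η‖ * bracket ξ η ^ 5 ≤ M) (hb' : ∀ᵐ η, ‖h' η‖ * bracket ξ η ^ 6 ≤ M) :
    ‖∫ η, lineIntegrand t ξ y m h η‖ ≤
      (22 + 4 * |y|) * M * ∫ η, |m η| * kernel t ξ η * (bracket ξ η ^ 3)⁻¹ := by
  set F : ℝ → ℂ := fun η =>
    amplitude t ξ y m h η * Complex.exp (-(Complex.I * (phase t ξ η : ℂ))) with hF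
  have hF' : ∀ᵐ η, HasDerivAt F (deriv F η) η ∧ ‖Complex.I * lineIntegrand t ξ y m h η - deriv F η‖
      ≤ (22 + 4 * |y|) * M * (|m η| * kernel t ξ η * (bracket ξ η ^ 3)⁻¹) := by
    filter_upwards [hd, hb'] with η h1 h2
    have hD := (hasDerivAt_amplitude ht hξ y (hm η) h1).mul (hasDerivAt_exp_phase hξ t η)
    refine ⟨hD.differentiableAt.hasDerivAt, ?_⟩
    have hD' : deriv F η = _ := hD.deriv
    rw [hD']
    refine le_trans (le_of_eq ?_) (norm_remainder_le ht hξ (y := y) (hmm η) (hb η) h2)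
    refine Eq.trans ?_ (norm_mul_exp_neg_I_mul _ (phase t ξ η))
    congr 1
    simp only [lineIntegrand, amplitude]
    push_cast
    ring
  have hN := integrable_lineIntegrand (t := t) (y := y) hξ hm1.continuous hmc hh.continuous hb
  have hB := (integrable_mul_kernel_line ht hξ hm1.continuous hmc).const_mul
    ((22 + 4 * |y|) * M)
  have hR : Integrable fun η => Complex.I * lineIntegrand t ξ y m h η - deriv F η := by
    refine hB.mono' ?_ (hF'.mono fun η hη => hη.2)
    exact ((hN.const_mul _).aestronglyMeasurable).sub (measurable_deriv F).aestronglyMeasurable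
  have hFint : Integrable (deriv F) := by
    have := (hN.const_mul Complex.I).sub hR
    refine this.congr (ae_of_all _ fun η => ?_)
    simp
  have hLip : LocallyLipschitz F := by
    refine locallyLipschitz_mul (locallyLipschitz_mul ?_ hh) ?_
    · have h1 := contDiff_weight ht hξ
      refine ContDiff.locallyLipschitz (𝕂 := ℝ) ?_
      have h2 : ContDiff ℝ 1 (fun η : ℝ => ((m η * weight t ξ η : ℝ) : ℂ)) :=
        Complex.ofRealCLM.contDiff.comp (hm1.mul h1)
      have h3 : ContDiff ℝ 1 (fun η : ℝ => ((y * η : ℝ) : ℂ)) :=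
        Complex.ofRealCLM.contDiff.comp (contDiff_const.mul contDiff_id)
      exact (contDiff_const.mul h3).cexp.mul h2
    · refine ContDiff.locallyLipschitz (𝕂 := ℝ) ?_
      have h3 : ContDiff ℝ 1 (fun η : ℝ => (phase t ξ η : ℂ)) :=
        Complex.ofRealCLM.contDiff.comp (contDiff_phase t ξ)
      exact (contDiff_const.mul h3).neg.cexp
  -- The boundary terms vanish: `W ≤ 4`, and `m h` decays like the inverse fourth power of the
  -- bracket.
  have hFle : ∀ η, ‖F η‖ ≤ 4 * c * M * (1 + η ^ 2)⁻¹ := by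
    intro η
    have hr1 := one_le_bracket ξ η
    have hr : 0 < bracket ξ η := lt_of_lt_of_le one_pos hr1
    have hM : 0 ≤ M := le_trans (by positivity) (hb η)
    have hc : 0 ≤ c := nonneg_of_mul_nonneg_left ((abs_nonneg _).trans (hmc η)) hr
    have b1 : ‖h η‖ ≤ M * (bracket ξ η ^ 5)⁻¹ := by
      rw [← div_eq_mul_inv, le_div_iff₀ (by positivity)]; exact hb η
    have hW0 := weight_nonneg t ξ η
    have hW : weight t ξ η ≤ 4 := by
      have := weight_le t ξ η
      have := sq_mul_kernel_le t ξ η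
      linarith
    have n4 : (bracket ξ η ^ 4)⁻¹ ≤ (bracket ξ η ^ 2)⁻¹ := by
      gcongr
      norm_num
    rw [hF]
    simp only [amplitude]
    rw [norm_mul, norm_mul, norm_mul, norm_exp_I_mul, norm_exp_neg_I_mul, Complex.norm_real,
      Real.norm_eq_abs, abs_mul, abs_of_nonneg hW0, one_mul, mul_one]
    calc |m η| * weight t ξ η * ‖h η‖
        ≤ (c * bracket ξ η) * 4 * (M * (bracket ξ η ^ 5)⁻¹) := by
          gcongr
          exact hmc η
      _ = 4 * c * M * (bracket ξ η ^ 4)⁻¹ := by field_simp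
      _ ≤ 4 * c * M * (1 + η ^ 2)⁻¹ := by
          exact mul_le_mul_of_nonneg_left (n4.trans (inv_bracket_sq_le ξ η)) (by positivity)
  obtain ⟨l1, l2⟩ := tendsto_zero_of_norm_le_inv_one_add_sq hFle
  have hzero := integral_eq_zero_of_ae_hasDerivAt hLip (hF'.mono fun η hη => hη.1) hFint l1 l2
  calc ‖∫ η, lineIntegrand t ξ y m h η‖
      = ‖∫ η, (Complex.I * lineIntegrand t ξ y m h η - deriv F η)‖ := by
        rw [integral_sub (hN.const_mul _) hFint, hzero, sub_zero, integral_const_mul, norm_mul,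
          Complex.norm_I, one_mul]
    _ ≤ ∫ η, (22 + 4 * |y|) * M * (|m η| * kernel t ξ η * (bracket ξ η ^ 3)⁻¹) :=
        norm_integral_le_of_norm_le hB (hF'.mono fun η hη => hη.2)
    _ = _ := integral_const_mul _ _

/-! ### Integrable majorants -/

/-- The one-dimensional majorant `|s|^{-1/2} ⟨s⟩^{-3/2}`. -/
def majorant (s : ℝ) : ℝ := (√|s|)⁻¹ * (√(√(1 + s ^ 2) ^ 3))⁻¹

theorem majorant_nonneg (s : ℝ) : 0 ≤ majorant s := by unfold majorant; positivity

theorem measurable_majorant : Measurable majorant := by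
  unfold majorant; fun_prop

theorem majorant_le_of_one_le {s : ℝ} (hs : 1 ≤ s) : majorant s ≤ 2 * (1 + s ^ 2)⁻¹ := by
  have h0 : 0 < s := by linarith
  set p := √(1 + s ^ 2) with hp
  have hp2 : p ^ 2 = 1 + s ^ 2 := Real.sq_sqrt (by positivity)
  have hp0 : 0 < p := Real.sqrt_pos.2 (by positivity)
  have hle : p ^ 2 ≤ 2 * (√s * √(p ^ 3)) := by
    have hps : p ≤ 2 * s := by
      refine abs_le_of_sq_le_sq' ?_ (by positivity) |>.2
      nlinarith
    rw [← Real.sqrt_mul h0.le]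
    have h3 : p ^ 2 / 2 ≤ √(s * p ^ 3) := by
      refine Real.le_sqrt_of_sq_le ?_
      have : p ^ 3 * p ≤ p ^ 3 * (2 * s) := by gcongr
      nlinarith [mul_pos h0 (pow_pos hp0 3)]
    linarith
  rw [majorant, abs_of_pos h0, ← hp, ← hp2, ← mul_inv, ← div_eq_mul_inv,
    inv_le_comm₀ (by positivity) (by positivity), inv_div]
  linarith

theorem majorant_le_of_pos {s : ℝ} (hs : 0 < s) :
    majorant s ≤ (Ioc (0 : ℝ) 1).indicator (fun x => x ^ (-(1 / 2) : ℝ)) s +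
      2 * (1 + s ^ 2)⁻¹ := by
  have h2 : 0 ≤ 2 * (1 + s ^ 2)⁻¹ := by positivity
  by_cases h : s ≤ 1
  · rw [indicator_of_mem (show s ∈ Ioc (0 : ℝ) 1 from ⟨hs, h⟩), Real.rpow_neg hs.le,
      ← Real.sqrt_eq_rpow]
    have h1 : 1 ≤ √(√(1 + s ^ 2) ^ 3) := by
      refine Real.one_le_sqrt.2 (one_le_pow₀ (Real.one_le_sqrt.2 ?_))
      nlinarith [sq_nonneg s]
    have : majorant s ≤ (√s)⁻¹ := by
      rw [majorant, abs_of_pos hs]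
      exact mul_le_of_le_one_right (by positivity) (inv_le_one_of_one_le₀ h1)
    linarith
  · rw [indicator_of_notMem (fun hc => h hc.2), zero_add]
    exact majorant_le_of_one_le (not_le.1 h).le

theorem integrable_majorant : Integrable majorant := by
  set f := (Ioi (0 : ℝ)).indicator majorant with hf
  have hfm : Measurable f := measurable_majorant.indicator measurableSet_Ioi
  have hf0 : ∀ s, 0 ≤ f s := fun s => indicator_nonneg (fun x _ => majorant_nonneg x) s
  have hr : Integrable ((Ioc (0 : ℝ) 1).indicator (fun x : ℝ => x ^ (-(1 / 2) : ℝ))) := by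
    rw [integrable_indicator_iff measurableSet_Ioc]
    exact (intervalIntegrable_iff_integrableOn_Ioc_of_le zero_le_one).1
      (intervalIntegral.intervalIntegrable_rpow' (by norm_num))
  have hfi : Integrable f := by
    refine (hr.add (integrable_inv_one_add_sq.const_mul 2)).mono' hfm.aestronglyMeasurable
      (ae_of_all _ fun s => ?_)
    rw [Real.norm_of_nonneg (hf0 s)]
    by_cases h : 0 < s
    · rw [hf, indicator_of_mem (show s ∈ Ioi (0 : ℝ) from h)]
      exact majorant_le_of_pos h
    · rw [hf, indicator_of_notMem (show s ∉ Ioi (0 : ℝ) from h)]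
      exact add_nonneg (indicator_nonneg (fun x hx => Real.rpow_nonneg hx.1.le _) s)
        (by positivity)
  refine (hfi.add hfi.comp_neg).mono' measurable_majorant.aestronglyMeasurable
    (ae_of_all _ fun s => ?_)
  rw [Real.norm_of_nonneg (majorant_nonneg s)]
  simp only [Pi.add_apply]
  rcases lt_trichotomy s 0 with h | h | h
  · have : f (-s) = majorant s := by
      rw [hf, indicator_of_mem (show -s ∈ Ioi (0 : ℝ) by simpa using h)]
      simp [majorant]
    linarith [hf0 s]
  · have : majorant s = 0 := by simp [majorant, h]
    linarith [hf0 s, hf0 (-s)]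
  · have : f s = majorant s := by
      rw [hf, indicator_of_mem (show s ∈ Ioi (0 : ℝ) from h)]
    linarith [hf0 (-s)]

/-- The power 3 of the bracket is shared equally between the two variables, so that the majorant
becomes a product. -/
theorem inv_mul_inv_bracket_le (ξ η : ℝ) :
    (√|ξ|)⁻¹ * (√|η|)⁻¹ * (bracket ξ η ^ 3)⁻¹ ≤ majorant ξ * majorant η := by
  have h1 : √(1 + ξ ^ 2) ≤ bracket ξ η := Real.sqrt_le_sqrt (by nlinarith [sq_nonneg η])
  have h2 : √(1 + η ^ 2) ≤ bracket ξ η := Real.sqrt_le_sqrt (by nlinarith [sq_nonneg ξ])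
  have hb : 0 ≤ bracket ξ η := Real.sqrt_nonneg _
  have h3 : √(√(1 + ξ ^ 2) ^ 3) * √(√(1 + η ^ 2) ^ 3) ≤ bracket ξ η ^ 3 := by
    calc √(√(1 + ξ ^ 2) ^ 3) * √(√(1 + η ^ 2) ^ 3)
        ≤ √(bracket ξ η ^ 3) * √(bracket ξ η ^ 3) := by gcongr
      _ = _ := Real.mul_self_sqrt (by positivity)
  have h4 : (bracket ξ η ^ 3)⁻¹ ≤ (√(√(1 + ξ ^ 2) ^ 3))⁻¹ * (√(√(1 + η ^ 2) ^ 3))⁻¹ := by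
    rw [← mul_inv]
    refine inv_anti₀ (by positivity) h3
  calc (√|ξ|)⁻¹ * (√|η|)⁻¹ * (bracket ξ η ^ 3)⁻¹
      ≤ (√|ξ|)⁻¹ * (√|η|)⁻¹ * ((√(√(1 + ξ ^ 2) ^ 3))⁻¹ * (√(√(1 + η ^ 2) ^ 3))⁻¹) := by
        gcongr
    _ = _ := by unfold majorant; ring

theorem abs_mul_kernel_le {t ξ η : ℝ} (ht : 0 < t) (hξ : ξ ≠ 0) (hη : η ≠ 0) :
    |ξ| * kernel t ξ η ≤ (t * √t)⁻¹ * ((√|ξ|)⁻¹ * (√|η|)⁻¹) := by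
  have hx : 0 < |ξ| := abs_pos.2 hξ
  have hy : 0 < |η| := abs_pos.2 hη
  set a := √|ξ| with ha
  set b := √|η| with hb
  set c := √t with hc
  have ha0 : 0 < a := Real.sqrt_pos.2 hx
  have hb0 : 0 < b := Real.sqrt_pos.2 hy
  have hc0 : 0 < c := Real.sqrt_pos.2 ht
  have ha2 : a ^ 2 = |ξ| := Real.sq_sqrt hx.le
  have hb2 : b ^ 2 = |η| := Real.sq_sqrt hy.le
  have hc2 : c ^ 2 = t := Real.sq_sqrt ht.le
  rw [kernel, ← sq_abs ξ, ← sq_abs η, ← ha2, ← hb2, ← hc2, ← mul_inv, ← mul_inv,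
    ← div_eq_mul_inv, div_le_iff₀ (by positivity), inv_mul_eq_div, le_div_iff₀ (by positivity)]
  -- Young's inequality in the variables `√(t|ξ|)` and `√|η|`, by comparing the larger one with the
  -- smaller.
  have key : (c * a) ^ 3 * b ≤ b ^ 4 + (c * a) ^ 4 := by
    have hca : 0 < c * a := by positivity
    rcases le_total b (c * a) with h | h
    · nlinarith [pow_pos hb0 4, pow_pos hca 3]
    · have : (c * a) ^ 3 ≤ b ^ 3 := by gcongr
      nlinarith [pow_pos hca 4]
  linarith

theorem integrable_majorant_prod :
    Integrable (fun p : ℝ × ℝ => majorant p.1 * majorant p.2) (volume.prod volume) :=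
  integrable_majorant.mul_prod integrable_majorant

/-- The total mass of the majorant. -/
def majorantMass : ℝ := ∫ s, majorant s

/-- From `η = (η - tξ) + tξ`. The loss `1 + t²` is acceptable for `t ≤ 1`, and for integrability at
each fixed time. -/
theorem invSymbol_le_mul (t : ℝ) {ξ : ℝ} (hξ : ξ ≠ 0) (η : ℝ) :
    invSymbol t ξ η ≤ 2 * (1 + t ^ 2) * (ξ ^ 2 + η ^ 2)⁻¹ := by
  have h1 : 0 < ξ ^ 2 + (η - t * ξ) ^ 2 := by positivity
  have h2 : 0 < ξ ^ 2 + η ^ 2 := by positivity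
  rw [invSymbol, ← div_eq_mul_inv, le_div_iff₀ h2, inv_mul_eq_div, div_le_iff₀ h1]
  nlinarith [sq_nonneg (η - 2 * t * ξ), sq_nonneg (η - t * ξ), sq_nonneg (t * ξ), sq_nonneg ξ,
    mul_nonneg (sq_nonneg t) (sq_nonneg (η - t * ξ))]

theorem mul_inv_sq_add_sq_le {m ξ η : ℝ} (hξ : ξ ≠ 0) (hη : η ≠ 0) (hm : m ^ 2 ≤ ξ ^ 2 + η ^ 2) :
    |m| * (ξ ^ 2 + η ^ 2)⁻¹ ≤ (√|ξ|)⁻¹ * (√|η|)⁻¹ := by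
  have h2 : 0 < ξ ^ 2 + η ^ 2 := by positivity
  have hx : 0 < √|ξ| := Real.sqrt_pos.2 (abs_pos.2 hξ)
  have hy : 0 < √|η| := Real.sqrt_pos.2 (abs_pos.2 hη)
  rw [← mul_inv, ← div_eq_mul_inv, div_le_iff₀ h2, inv_mul_eq_div, le_div_iff₀ (by positivity)]
  have e1 : √|ξ| * √|η| ≤ √(ξ ^ 2 + η ^ 2) := by
    rw [← Real.sqrt_mul (abs_nonneg _)]
    refine Real.sqrt_le_sqrt ?_
    rw [← sq_abs ξ, ← sq_abs η]
    nlinarith [sq_nonneg (|ξ| - |η|), abs_nonneg ξ, abs_nonneg η]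
  calc |m| * (√|ξ| * √|η|) ≤ √(ξ ^ 2 + η ^ 2) * √(ξ ^ 2 + η ^ 2) := by
        gcongr
        exact Real.abs_le_sqrt hm
    _ = _ := Real.mul_self_sqrt h2.le

theorem ae_ne_zero_prod :
    ∀ᵐ p : ℝ × ℝ ∂(volume.prod volume), p.1 ≠ 0 ∧ p.2 ≠ 0 := by
  have h : ∀ᵐ x : ℝ, x ≠ 0 := by simp [ae_iff]
  exact (Measure.quasiMeasurePreserving_fst.ae h).and (Measure.quasiMeasurePreserving_snd.ae h)

/-! ### The Poisson-type kernel -/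

/-- After rescaling by `t/|η|` this is the integral of `1/(1 + x²)`, so the mass does not depend on
`η`. -/
theorem integrable_poisson {t η : ℝ} (ht : 0 < t) (hη : η ≠ 0) :
    Integrable (fun ξ => |η| * kernel t ξ η) ∧ ∫ ξ, |η| * kernel t ξ η = Real.pi / t := by
  have hy : 0 < |η| := abs_pos.2 hη
  have e : (fun ξ => |η| * kernel t ξ η) =
      fun ξ => |η|⁻¹ * (fun x : ℝ => (1 + x ^ 2)⁻¹) (t / |η| * ξ) := by
    funext ξ
    simp only [kernel]
    rw [← sq_abs η]
    field_simp
  have hc : t / |η| ≠ 0 := by positivity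
  rw [e]
  refine ⟨(integrable_inv_one_add_sq.comp_mul_left' hc).const_mul _, ?_⟩
  rw [integral_const_mul, Measure.integral_comp_mul_left (fun x : ℝ => (1 + x ^ 2)⁻¹) (t / |η|),
    integral_univ_inv_one_add_sq,
    abs_of_pos (by positivity : 0 < (t / |η|)⁻¹), smul_eq_mul]
  field_simp

theorem measurable_kernel (t : ℝ) : Measurable fun p : ℝ × ℝ => kernel t p.1 p.2 := by
  unfold kernel; fun_prop

theorem measurable_invSymbol (t : ℝ) : Measurable fun p : ℝ × ℝ => invSymbol t p.1 p.2 := by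
  unfold invSymbol; fun_prop

theorem measurable_bracket : Measurable fun p : ℝ × ℝ => bracket p.1 p.2 := by
  unfold bracket; fun_prop

theorem measurable_phase (t : ℝ) : Measurable fun p : ℝ × ℝ => phase t p.1 p.2 := by
  unfold phase; fun_prop

theorem integrable_poisson_prod {t : ℝ} (ht : 0 < t) :
    Integrable (fun p : ℝ × ℝ => |p.2| * kernel t p.1 p.2 * (1 + p.2 ^ 2)⁻¹)
        (volume.prod volume) ∧
      ∫ p : ℝ × ℝ, |p.2| * kernel t p.1 p.2 * (1 + p.2 ^ 2)⁻¹ ∂(volume.prod volume) =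
        Real.pi / t * Real.pi := by
  have hm : Measurable fun p : ℝ × ℝ => |p.2| * kernel t p.1 p.2 * (1 + p.2 ^ 2)⁻¹ := by
    have := measurable_kernel t
    fun_prop
  have hne : ∀ᵐ x : ℝ, x ≠ 0 := by simp [ae_iff]
  have hval : ∀ᵐ η : ℝ, ∫ ξ, |η| * kernel t ξ η * (1 + η ^ 2)⁻¹ =
      Real.pi / t * (1 + η ^ 2)⁻¹ := by
    filter_upwards [hne] with η hη
    rw [integral_mul_const, (integrable_poisson ht hη).2]
  have hint : Integrable (fun p : ℝ × ℝ => |p.2| * kernel t p.1 p.2 * (1 + p.2 ^ 2)⁻¹)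
      (volume.prod volume) := by
    rw [integrable_prod_iff' hm.aestronglyMeasurable]
    refine ⟨?_, ?_⟩
    · filter_upwards [hne] with η hη
      exact (integrable_poisson ht hη).1.mul_const _
    · refine (integrable_inv_one_add_sq.const_mul (Real.pi / t)).congr ?_
      filter_upwards [hval] with η hη
      rw [← hη]
      refine integral_congr_ae (ae_of_all _ fun ξ => ?_)
      have := kernel_nonneg t ξ η
      exact (Real.norm_of_nonneg (by positivity)).symm
  refine ⟨hint, ?_⟩
  rw [integral_prod_symm _ hint, integral_congr_ae hval, integral_const_mul,
    integral_univ_inv_one_add_sq]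

/-! ### Oscillatory integrals over the frequency plane -/

/-- The Fourier density `m(ξ, η) / (ξ² + (η - tξ)²) e^{-iΦ} g(ξ, η)`. -/
def density (t : ℝ) (m : ℝ → ℝ → ℝ) (g : ℝ × ℝ → ℂ) (q : ℝ × ℝ) : ℂ :=
  ((m q.1 q.2 * invSymbol t q.1 q.2 : ℝ) : ℂ) *
    (Complex.exp (-(Complex.I * (phase t q.1 q.2 : ℂ))) * g q)

/-- The character `e^{i(ξ z + η y)}`. -/
def character (z y : ℝ) (q : ℝ × ℝ) : ℂ :=
  Complex.exp (Complex.I * ((q.1 * z + q.2 * y : ℝ) : ℂ))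

/-- Pointwise bounds on the Fourier transform `g` of the initial vorticity. -/
structure IsAdmissible (g : ℝ × ℝ → ℂ) (M : ℝ) : Prop where
  continuous : Continuous g
  locallyLipschitz : ∀ ξ, LocallyLipschitz fun η => g (ξ, η)
  norm_le : ∀ ξ η, ‖g (ξ, η)‖ * bracket ξ η ^ 5 ≤ M
  deriv_le : ∃ g' : ℝ → ℝ → ℂ, ∀ᵐ ξ, ∀ᵐ η, HasDerivAt (fun s => g (ξ, s)) (g' ξ η) η ∧
    ‖g' ξ η‖ * bracket ξ η ^ 6 ≤ M

/-- Bounds on the multiplier `m`, satisfied by `ξ` and by `η`. -/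
structure IsMultiplier (m : ℝ → ℝ → ℝ) : Prop where
  measurable : Measurable fun q : ℝ × ℝ => m q.1 q.2
  sq_le : ∀ ξ η, m ξ η ^ 2 ≤ ξ ^ 2 + η ^ 2
  contDiff : ∀ ξ, ContDiff ℝ 1 (m ξ)
  deriv_le : ∀ ξ η, |η| * |deriv (m ξ) η| ≤ |m ξ η|

theorem isMultiplier_fst : IsMultiplier fun ξ _ => ξ where
  measurable := measurable_fst
  sq_le ξ η := by nlinarith [sq_nonneg η]
  contDiff ξ := contDiff_const
  deriv_le ξ η := by simp

theorem isMultiplier_snd : IsMultiplier fun _ η => η where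
  measurable := measurable_snd
  sq_le ξ η := by nlinarith [sq_nonneg ξ]
  contDiff ξ := contDiff_id
  deriv_le ξ η := by simp

theorem IsMultiplier.abs_le {m : ℝ → ℝ → ℝ} (hm : IsMultiplier m) (ξ η : ℝ) :
    |m ξ η| ≤ bracket ξ η :=
  Real.abs_le_sqrt (by linarith [hm.sq_le ξ η])

theorem IsAdmissible.nonneg {g : ℝ × ℝ → ℂ} {M : ℝ} (hg : IsAdmissible g M) : 0 ≤ M :=
  le_trans (by have := one_le_bracket 0 0; positivity) (hg.norm_le 0 0)

theorem norm_density (t : ℝ) (m : ℝ → ℝ → ℝ) (g : ℝ × ℝ → ℂ) (q : ℝ × ℝ) :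
    ‖density t m g q‖ = |m q.1 q.2| * invSymbol t q.1 q.2 * ‖g q‖ := by
  rw [density, norm_mul, norm_mul, norm_exp_neg_I_mul, Complex.norm_real, Real.norm_eq_abs,
    abs_mul, abs_of_nonneg (invSymbol_nonneg _ _ _), one_mul]

theorem norm_character (z y : ℝ) (q : ℝ × ℝ) : ‖character z y q‖ = 1 := norm_exp_I_mul _

theorem measurable_character (z y : ℝ) : Measurable (character z y) := by
  unfold character; fun_prop

theorem measurable_density (t : ℝ) {m : ℝ → ℝ → ℝ} (hm : IsMultiplier m) {g : ℝ × ℝ → ℂ}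
    (hg : Continuous g) : Measurable (density t m g) := by
  have h1 := measurable_invSymbol t
  have h2 := measurable_phase t
  have h3 := hm.measurable
  have h4 := hg.measurable
  unfold density
  fun_prop

theorem norm_density_le (t : ℝ) {m : ℝ → ℝ → ℝ} (hm : IsMultiplier m) {g : ℝ × ℝ → ℂ} {M : ℝ}
    (hg : IsAdmissible g M) {q : ℝ × ℝ} (h1 : q.1 ≠ 0) (h2 : q.2 ≠ 0) :
    ‖density t m g q‖ ≤ 2 * (1 + t ^ 2) * M * (majorant q.1 * majorant q.2) := by
  obtain ⟨ξ, η⟩ := q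
  simp only at h1 h2
  rw [norm_density]
  set r := bracket ξ η
  have hr1 : 1 ≤ r := one_le_bracket ξ η
  have hr : 0 < r := by linarith
  have hM := hg.nonneg
  have b1 : ‖g (ξ, η)‖ ≤ M * (r ^ 5)⁻¹ := by
    rw [← div_eq_mul_inv, le_div_iff₀ (by positivity)]; exact hg.norm_le ξ η
  have n3 : (r ^ 5)⁻¹ ≤ (r ^ 3)⁻¹ := by
    gcongr
    norm_num
  calc |m ξ η| * invSymbol t ξ η * ‖g (ξ, η)‖
      ≤ |m ξ η| * (2 * (1 + t ^ 2) * (ξ ^ 2 + η ^ 2)⁻¹) * (M * (r ^ 3)⁻¹) := by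
        gcongr
        · exact invSymbol_le_mul t h1 η
        · exact b1.trans (by gcongr)
    _ = 2 * (1 + t ^ 2) * M * ((|m ξ η| * (ξ ^ 2 + η ^ 2)⁻¹) * (r ^ 3)⁻¹) := by ring
    _ ≤ 2 * (1 + t ^ 2) * M * (((√|ξ|)⁻¹ * (√|η|)⁻¹) * (r ^ 3)⁻¹) := by
        exact mul_le_mul_of_nonneg_left (mul_le_mul_of_nonneg_right
          (mul_inv_sq_add_sq_le h1 h2 (hm.sq_le ξ η)) (by positivity)) (by positivity)
    _ ≤ _ := mul_le_mul_of_nonneg_left (inv_mul_inv_bracket_le ξ η) (by positivity)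

theorem integrable_density (t : ℝ) {m : ℝ → ℝ → ℝ} (hm : IsMultiplier m) {g : ℝ × ℝ → ℂ} {M : ℝ}
    (hg : IsAdmissible g M) : Integrable (density t m g) (volume.prod volume) := by
  refine (integrable_majorant_prod.const_mul (2 * (1 + t ^ 2) * M)).mono'
    (measurable_density t hm hg.continuous).aestronglyMeasurable ?_
  filter_upwards [ae_ne_zero_prod] with q hq
  exact norm_density_le t hm hg hq.1 hq.2

theorem norm_integral_density_le (t z y : ℝ) {m : ℝ → ℝ → ℝ} (hm : IsMultiplier m)
    {g : ℝ × ℝ → ℂ} {M : ℝ} (hg : IsAdmissible g M) :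
    ‖∫ q : ℝ × ℝ, character z y q * density t m g q ∂(volume.prod volume)‖ ≤
      2 * (1 + t ^ 2) * M * majorantMass ^ 2 := by
  have h : ∫ q : ℝ × ℝ, 2 * (1 + t ^ 2) * M * (majorant q.1 * majorant q.2)
      ∂(volume.prod volume) = 2 * (1 + t ^ 2) * M * majorantMass ^ 2 := by
    rw [integral_const_mul, integral_prod_mul, majorantMass, sq (∫ s, majorant s)]
  rw [← h]
  refine norm_integral_le_of_norm_le (integrable_majorant_prod.const_mul _) ?_
  filter_upwards [ae_ne_zero_prod] with q hq
  rw [norm_mul, norm_character, one_mul]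
  exact norm_density_le t hm hg hq.1 hq.2

theorem integrable_character_mul_density (t z y : ℝ) {m : ℝ → ℝ → ℝ} (hm : IsMultiplier m)
    {g : ℝ × ℝ → ℂ} {M : ℝ} (hg : IsAdmissible g M) :
    Integrable (fun q => character z y q * density t m g q) (volume.prod volume) :=
  (integrable_density t hm hg).bdd_mul (c := 1) (measurable_character z y).aestronglyMeasurable
    (ae_of_all _ fun q => (norm_character z y q).le)

/-- Fubini with `ξ` outside. Cancellation is used only in `η`; the factor `e^{iξz}` is constant on
each line, so the bound is uniform in `z`. -/
theorem norm_integral_density_le_kernel {t : ℝ} (ht : 0 < t) (z y : ℝ) {m : ℝ → ℝ → ℝ}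
    (hm : IsMultiplier m) {g : ℝ × ℝ → ℂ} {M : ℝ} (hg : IsAdmissible g M)
    (hint : Integrable (fun q : ℝ × ℝ => |m q.1 q.2| * kernel t q.1 q.2 *
      (bracket q.1 q.2 ^ 3)⁻¹) (volume.prod volume)) :
    ‖∫ q : ℝ × ℝ, character z y q * density t m g q ∂(volume.prod volume)‖ ≤
      (22 + 4 * |y|) * M * ∫ q : ℝ × ℝ, |m q.1 q.2| * kernel t q.1 q.2 *
        (bracket q.1 q.2 ^ 3)⁻¹ ∂(volume.prod volume) := by
  obtain ⟨g', hg'⟩ := hg.deriv_le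
  have hne : ∀ᵐ x : ℝ, x ≠ 0 := by simp [ae_iff]
  rw [integral_prod _ (integrable_character_mul_density t z y hm hg), integral_prod _ hint,
    ← integral_const_mul]
  refine norm_integral_le_of_norm_le (hint.integral_prod_left.const_mul _) ?_
  filter_upwards [hg', hne] with ξ h1 hξ
  have e : (fun η => character z y (ξ, η) * density t m g (ξ, η)) = fun η =>
      Complex.exp (Complex.I * ((ξ * z : ℝ) : ℂ)) *
        lineIntegrand t ξ y (m ξ) (fun s => g (ξ, s)) η := by
    funext η
    simp only [character, density, lineIntegrand]
    rw [← mul_assoc (Complex.exp _) (Complex.exp _), ← Complex.exp_add]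
    congr 3
    push_cast
    ring
  rw [e, integral_const_mul, norm_mul, norm_exp_I_mul, one_mul]
  refine norm_integral_lineIntegrand_le (c := 1) ht hξ y (hm.contDiff ξ)
    (fun η => ((hm.contDiff ξ).differentiable one_ne_zero η).hasDerivAt) (hm.deriv_le ξ)
    (fun η => by rw [one_mul]; exact hm.abs_le ξ η) (hg.locallyLipschitz ξ)
    (h1.mono fun η h => h.1) (hg.norm_le ξ) (h1.mono fun η h => h.2)

theorem norm_integral_density_fst_le {t : ℝ} (ht : 0 < t) (z y : ℝ) {g : ℝ × ℝ → ℂ} {M : ℝ}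
    (hg : IsAdmissible g M) :
    ‖∫ q : ℝ × ℝ, character z y q * density t (fun ξ _ => ξ) g q ∂(volume.prod volume)‖ ≤
      (22 + 4 * |y|) * M * ((t * √t)⁻¹ * majorantMass ^ 2) := by
  have hle : ∀ᵐ q : ℝ × ℝ ∂(volume.prod volume), |q.1| * kernel t q.1 q.2 *
      (bracket q.1 q.2 ^ 3)⁻¹ ≤ (t * √t)⁻¹ * (majorant q.1 * majorant q.2) := by
    filter_upwards [ae_ne_zero_prod] with q hq
    have hb := one_le_bracket q.1 q.2
    calc |q.1| * kernel t q.1 q.2 * (bracket q.1 q.2 ^ 3)⁻¹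
        ≤ (t * √t)⁻¹ * ((√|q.1|)⁻¹ * (√|q.2|)⁻¹) * (bracket q.1 q.2 ^ 3)⁻¹ := by
          exact mul_le_mul_of_nonneg_right (abs_mul_kernel_le ht hq.1 hq.2) (by positivity)
      _ = (t * √t)⁻¹ * ((√|q.1|)⁻¹ * (√|q.2|)⁻¹ * (bracket q.1 q.2 ^ 3)⁻¹) := by ring
      _ ≤ _ := mul_le_mul_of_nonneg_left (inv_mul_inv_bracket_le _ _) (by positivity)
  have hmaj := integrable_majorant_prod.const_mul (t * √t)⁻¹
  have hint : Integrable (fun q : ℝ × ℝ => |q.1| * kernel t q.1 q.2 *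
      (bracket q.1 q.2 ^ 3)⁻¹) (volume.prod volume) := by
    refine hmaj.mono' ?_ ?_
    · have h1 := measurable_kernel t
      have h2 := measurable_bracket
      exact (by fun_prop : Measurable fun q : ℝ × ℝ => |q.1| * kernel t q.1 q.2 *
        (bracket q.1 q.2 ^ 3)⁻¹).aestronglyMeasurable
    · filter_upwards [hle] with q hq
      have hb := one_le_bracket q.1 q.2
      have hk := kernel_nonneg t q.1 q.2
      rwa [Real.norm_of_nonneg (by positivity)]
  refine (norm_integral_density_le_kernel ht z y isMultiplier_fst hg hint).trans ?_
  have hM := hg.nonneg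
  gcongr
  refine (integral_mono_ae hint hmaj hle).trans (le_of_eq ?_)
  rw [integral_const_mul, integral_prod_mul, majorantMass, sq (∫ s, majorant s)]

theorem norm_integral_density_snd_le {t : ℝ} (ht : 0 < t) (z y : ℝ) {g : ℝ × ℝ → ℂ} {M : ℝ}
    (hg : IsAdmissible g M) :
    ‖∫ q : ℝ × ℝ, character z y q * density t (fun _ η => η) g q ∂(volume.prod volume)‖ ≤
      (22 + 4 * |y|) * M * (Real.pi / t * Real.pi) := by
  have hle : ∀ q : ℝ × ℝ, |q.2| * kernel t q.1 q.2 * (bracket q.1 q.2 ^ 3)⁻¹ ≤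
      |q.2| * kernel t q.1 q.2 * (1 + q.2 ^ 2)⁻¹ := by
    intro q
    have hk := kernel_nonneg t q.1 q.2
    have hb := one_le_bracket q.1 q.2
    have n3 : (bracket q.1 q.2 ^ 3)⁻¹ ≤ (bracket q.1 q.2 ^ 2)⁻¹ := by
      gcongr
      norm_num
    exact mul_le_mul_of_nonneg_left (n3.trans (inv_bracket_sq_le _ _)) (by positivity)
  obtain ⟨hmaj, hval⟩ := integrable_poisson_prod ht
  have hint : Integrable (fun q : ℝ × ℝ => |q.2| * kernel t q.1 q.2 *
      (bracket q.1 q.2 ^ 3)⁻¹) (volume.prod volume) := by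
    refine hmaj.mono' ?_ (ae_of_all _ fun q => ?_)
    · have h1 := measurable_kernel t
      have h2 := measurable_bracket
      exact (by fun_prop : Measurable fun q : ℝ × ℝ => |q.2| * kernel t q.1 q.2 *
        (bracket q.1 q.2 ^ 3)⁻¹).aestronglyMeasurable
    · have hb := one_le_bracket q.1 q.2
      have hk := kernel_nonneg t q.1 q.2
      rw [Real.norm_of_nonneg (by positivity)]
      exact hle q
  refine (norm_integral_density_le_kernel ht z y isMultiplier_snd hg hint).trans ?_
  have hM := hg.nonneg
  gcongr
  exact (integral_mono hint hmaj hle).trans (le_of_eq hval)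

/-! ### The plane as a product, and shears -/

/-- The identification of the Euclidean plane with `ℝ × ℝ`. -/
def planeEquiv : Plane ≃ᵐ ℝ × ℝ :=
  (MeasurableEquiv.toLp 2 (Fin 2 → ℝ)).symm.trans MeasurableEquiv.finTwoArrow

theorem planeEquiv_apply (k : Plane) : planeEquiv k = (k 0, k 1) := rfl

theorem planeEquiv_symm_apply (q : ℝ × ℝ) : planeEquiv.symm q = !₂[q.1, q.2] := rfl

theorem measurePreserving_planeEquiv :
    MeasurePreserving planeEquiv (volume : Measure Plane) (volume.prod volume) :=
  (EuclideanSpace.volume_preserving_symm_measurableEquiv_toLp (Fin 2)).trans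
    (volume_preserving_finTwoArrow ℝ)

/-- The shear `(p₀, p₁) ↦ (p₀ + t p₁, p₁)` of the position plane. -/
def positionShear (t : ℝ) : Plane ≃L[ℝ] Plane :=
  LinearEquiv.toContinuousLinearEquiv
    { toFun := fun p => !₂[p 0 + t * p 1, p 1]
      invFun := fun p => !₂[p 0 - t * p 1, p 1]
      map_add' := fun p q => by ext i; fin_cases i <;> simp; ring
      map_smul' := fun c p => by ext i; fin_cases i <;> simp; ring
      left_inv := fun p => by ext i; fin_cases i <;> simp
      right_inv := fun p => by ext i; fin_cases i <;> simp }

theorem positionShear_apply (t : ℝ) (p : Plane) :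
    positionShear t p = !₂[p 0 + t * p 1, p 1] := rfl

/-- The shear `(k₀, k₁) ↦ (k₀, k₁ + t k₀)` of the frequency plane. -/
def frequencyShear (t : ℝ) (k : Plane) : Plane := !₂[k 0, k 1 + t * k 0]

theorem measurePreserving_prod_shear (t : ℝ) :
    MeasurePreserving (fun q : ℝ × ℝ => (q.1, q.2 + t * q.1)) (volume.prod volume)
      (volume.prod volume) :=
  (MeasurePreserving.id volume).skew_product (g := fun a b => b + t * a)
    (by unfold Function.uncurry; fun_prop)
    (ae_of_all _ fun a => (measurePreserving_add_right volume (t * a)).map_eq)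

theorem measurePreserving_frequencyShear (t : ℝ) :
    MeasurePreserving (frequencyShear t) (volume : Measure Plane) volume :=
  (measurePreserving_planeEquiv.symm).comp
    ((measurePreserving_prod_shear t).comp measurePreserving_planeEquiv)

theorem measurePreserving_positionShear (t : ℝ) :
    MeasurePreserving (positionShear t) (volume : Measure Plane) volume :=
  -- The product shear moves the second coordinate; conjugating by the swap makes it move the first.
  (measurePreserving_planeEquiv.symm).comp (Measure.measurePreserving_swap.comp
    ((measurePreserving_prod_shear t).comp
      (Measure.measurePreserving_swap.comp measurePreserving_planeEquiv)))

theorem frequencyShear_neg_frequencyShear (t : ℝ) (k : Plane) :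
    frequencyShear (-t) (frequencyShear t k) = k := by
  ext i; fin_cases i <;> simp [frequencyShear]

theorem measurableEmbedding_frequencyShear (t : ℝ) : MeasurableEmbedding (frequencyShear t) :=
  (MeasurableEquiv.mk (Equiv.mk (frequencyShear t) (frequencyShear (-t))
    (frequencyShear_neg_frequencyShear t) (fun k => by
      simpa using frequencyShear_neg_frequencyShear (-t) k))
    (measurePreserving_frequencyShear t).measurable
    (measurePreserving_frequencyShear (-t)).measurable).measurableEmbedding

/-! ### The Fourier transform and shears -/

theorem inner_plane (u k : Plane) : inner ℝ u k = u 0 * k 0 + u 1 * k 1 := by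
  simp [PiLp.inner_apply, mul_comm]

theorem fourier_comp_positionShear (t : ℝ) (f : Plane → ℂ) (k : Plane) :
    𝓕 (f ∘ positionShear t) k = 𝓕 f (frequencyShear (-t) k) := by
  rw [Real.fourier_eq', Real.fourier_eq',
    ← (measurePreserving_positionShear t).integral_comp
      (positionShear t).toHomeomorph.measurableEmbedding
      (fun u => Complex.exp ((↑(-2 * Real.pi * inner ℝ u (frequencyShear (-t) k)) * Complex.I)) •
        f u)]
  congr 1
  funext v
  have : inner ℝ (positionShear t v) (frequencyShear (-t) k) = inner ℝ v k := by
    rw [inner_plane, inner_plane, positionShear_apply, frequencyShear]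
    simp
    ring
  rw [this]
  rfl

/-- Both sides are continuous in `u` on `L²`, so it suffices to treat Schwartz functions, where the
Fourier integral and a change of variables apply. The frequency map is the inverse transpose of the
position shear. -/
theorem fourier_compMeasurePreserving_positionShear (t : ℝ)
    (u : Lp ℂ 2 (volume : Measure Plane)) :
    (𝓕 (Lp.compMeasurePreserving (positionShear t) (measurePreserving_positionShear t) u) :
      Lp ℂ 2 (volume : Measure Plane)) =
    Lp.compMeasurePreserving (frequencyShear (-t)) (measurePreserving_frequencyShear (-t))
      (𝓕 u : Lp ℂ 2 (volume : Measure Plane)) := by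
  refine DenseRange.induction_on (SchwartzMap.denseRange_toLpCLM (E := Plane) (F := ℂ) (p := 2)
    (μ := volume) ENNReal.ofNat_ne_top) u ?_ ?_
  · refine isClosed_eq ?_ ?_
    · exact (Lp.fourierTransformₗᵢ Plane ℂ).continuous.comp
        (Lp.isometry_compMeasurePreserving _).continuous
    · exact (Lp.isometry_compMeasurePreserving _).continuous.comp
        (Lp.fourierTransformₗᵢ Plane ℂ).continuous
  · intro f
    rw [SchwartzMap.toLpCLM_apply]
    set h : SchwartzMap Plane ℂ :=
      SchwartzMap.compCLMOfContinuousLinearEquiv ℝ (positionShear t) f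
    have h1 : Lp.compMeasurePreserving (positionShear t) (measurePreserving_positionShear t)
        (f.toLp 2) = h.toLp 2 := by
      refine Lp.ext ?_
      refine (Lp.coeFn_compMeasurePreserving _ _).trans ?_
      refine ((measurePreserving_positionShear t).quasiMeasurePreserving.ae_eq_comp
        (f.coeFn_toLp 2)).trans ?_
      exact (h.coeFn_toLp 2).symm
    rw [h1, SchwartzMap.toLp_fourier_eq, SchwartzMap.toLp_fourier_eq]
    refine Lp.ext ?_
    have h2 : ((𝓕 h : SchwartzMap Plane ℂ) : Plane → ℂ) =
        (𝓕 f : SchwartzMap Plane ℂ) ∘ frequencyShear (-t) :=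
      funext fun k => fourier_comp_positionShear t f k
    have h3 := (𝓕 f : SchwartzMap Plane ℂ).coeFn_toLp 2 volume
    refine ((𝓕 h : SchwartzMap Plane ℂ).coeFn_toLp 2 volume).trans ?_
    rw [h2]
    exact ((measurePreserving_frequencyShear (-t)).quasiMeasurePreserving.ae_eq_comp h3).symm.trans
      (Lp.coeFn_compMeasurePreserving _ _).symm

theorem quasiMeasurePreserving_const_smul {c : ℝ} (hc : c ≠ 0) :
    Measure.QuasiMeasurePreserving (fun k : Plane => c • k) volume volume := by
  refine ⟨by fun_prop, ?_⟩
  rw [Measure.map_addHaar_smul _ hc]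
  exact Measure.smul_absolutelyContinuous

theorem planeFourier_congr {v w : Plane → ℂ} (h : v =ᵐ[volume] w) :
    planeFourier v = planeFourier w := by
  funext k
  unfold planeFourier
  by_cases hv : MemLp v 2 (volume : Measure Plane)
  · have hw : MemLp w 2 (volume : Measure Plane) := (memLp_congr_ae h).1 hv
    rw [dif_pos hv, dif_pos hw, (MemLp.toLp_eq_toLp_iff hv hw).2 h]
  · have hw : ¬ MemLp w 2 (volume : Measure Plane) := fun hw => hv ((memLp_congr_ae h).2 hw)
    rw [dif_neg hv, dif_neg hw]

theorem planeFourier_comp_positionShear (t : ℝ) {w : Plane → ℂ}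
    (hw : MemLp w 2 (volume : Measure Plane)) :
    planeFourier (w ∘ positionShear t) =ᵐ[volume]
      fun k => planeFourier w (frequencyShear (-t) k) := by
  have hw' : MemLp (w ∘ positionShear t) 2 (volume : Measure Plane) :=
    hw.comp_measurePreserving (measurePreserving_positionShear t)
  have h1 : hw'.toLp (w ∘ positionShear t) = Lp.compMeasurePreserving (positionShear t)
      (measurePreserving_positionShear t) (hw.toLp w) :=
    (Lp.toLp_compMeasurePreserving hw (measurePreserving_positionShear t)).symm
  have h2 : ((𝓕 (hw'.toLp (w ∘ positionShear t)) : Lp ℂ 2 (volume : Measure Plane)) : Plane → ℂ)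
      =ᵐ[volume] (𝓕 (hw.toLp w) : Lp ℂ 2 (volume : Measure Plane)) ∘ frequencyShear (-t) := by
    rw [h1, fourier_compMeasurePreserving_positionShear]
    exact Lp.coeFn_compMeasurePreserving _ _
  have hc : (2 * Real.pi)⁻¹ ≠ 0 := by positivity
  filter_upwards [(quasiMeasurePreserving_const_smul hc).ae h2] with k hk
  simp only [planeFourier, dif_pos hw, dif_pos hw']
  rw [hk, Function.comp_apply]
  congr 1
  ext i
  fin_cases i <;> simp [frequencyShear]
  ring

/-! ### The explicit solution -/

/-- Integrating factor: `e^{iΦ} F` has zero derivative on the half-line, and `Φ` vanishes at time 0.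
-/
theorem eq_exp_phase_mul {ξ η : ℝ} (hξ : ξ ≠ 0) {F : ℝ → ℂ}
    (hF : ∀ t, 0 ≤ t → HasDerivWithinAt F
      (-(Complex.I * (ξ : ℂ) * (invSymbol t ξ η : ℂ)) * F t) (Ici 0) t) {t : ℝ} (ht : 0 ≤ t) :
    F t = Complex.exp (-(Complex.I * (phase t ξ η : ℂ))) * F 0 := by
  set H : ℝ → ℂ := fun s => Complex.exp (Complex.I * (phase s ξ η : ℂ)) * F s with hH
  have hd : ∀ s, 0 ≤ s → HasDerivWithinAt H 0 (Ici 0) s := by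
    intro s hs
    have h1 := (((hasDerivAt_phase_time hξ s η).ofReal_comp.const_mul Complex.I).cexp)
    refine (h1.hasDerivWithinAt.mul (hF s hs)).congr_deriv ?_
    push_cast
    ring
  have hc := constant_of_has_deriv_right_zero (f := H) (a := 0) (b := t)
    (fun s hs => ((hd s hs.1).continuousWithinAt).mono Icc_subset_Ici_self)
    (fun s hs => (hd s hs.1).mono (Ici_subset_Ici.2 hs.1)) t (right_mem_Icc.2 ht)
  simp only [hH, phase_zero, Complex.ofReal_zero, mul_zero, Complex.exp_zero, one_mul] at hc
  rw [← hc, ← mul_assoc, ← Complex.exp_add, neg_add_cancel, Complex.exp_zero, one_mul]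

theorem ae_coord_ne_zero : ∀ᵐ k : Plane, k 0 ≠ 0 :=
  (measurePreserving_planeEquiv.quasiMeasurePreserving.ae ae_ne_zero_prod).mono fun _ h => h.1

theorem planeFourier_profile_eq {ω₀ g : Plane → ℂ} {ω : ℝ → Plane → ℂ}
    (hg : g =ᵐ[volume] planeFourier ω₀) (hω : IsBetaPlaneSolution ω₀ ω) {t : ℝ} (ht : 0 ≤ t) :
    planeFourier (vorticityProfile ω t) =ᵐ[volume]
      fun k => Complex.exp (-(Complex.I * (phase t (k 0) (k 1) : ℂ))) * g k := by
  obtain ⟨F, hF, hode⟩ := hω.evolution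
  have h0 : vorticityProfile ω 0 = ω 0 := by
    funext p
    simp only [vorticityProfile, zero_mul, add_zero]
    congr 1
    ext i; fin_cases i <;> simp
  have hF0 := hF 0 le_rfl
  rw [h0, planeFourier_congr hω.initial] at hF0
  filter_upwards [hF t ht, hF0, hg, hode, ae_coord_ne_zero] with k h1 h2 h3 h4 h5
  rw [← h1, h3, ← h2]
  refine eq_exp_phase_mul h5 (F := fun s => F s k) (fun s hs => ?_) ht
  refine (h4 s hs).congr_deriv ?_
  rw [div_eq_mul_inv, ← Complex.ofReal_inv]
  rfl

/-! ### The data norm -/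

theorem japaneseBracket_norm (k : Plane) : japaneseBracket ‖k‖ = bracket (k 0) (k 1) := by
  rw [japaneseBracket, bracket, EuclideanSpace.real_norm_sq_eq, Fin.sum_univ_two, add_assoc]

theorem ae_le_toReal_of_eLpNorm_le {f : Plane → ℝ} {N : ℝ≥0∞} (hN : N < ⊤)
    (h : eLpNorm f ⊤ volume ≤ N) : ∀ᵐ k : Plane, f k ≤ N.toReal := by
  rw [eLpNorm_exponent_top] at h
  filter_upwards [ae_le_eLpNormEssSup (f := f) (μ := (volume : Measure Plane))] with k hk
  have h1 : ‖f k‖ₑ.toReal ≤ N.toReal := ENNReal.toReal_mono hN.ne (hk.trans h)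
  rw [toReal_enorm] at h1
  exact (le_abs_self _).trans h1

theorem vec_eq_add_smul (ξ s : ℝ) :
    (!₂[ξ, s] : Plane) = !₂[ξ, 0] + s • EuclideanSpace.single 1 (1 : ℝ) := by
  ext i; fin_cases i <;> simp

theorem isAdmissible_of_dataNorm {g : Plane → ℂ} (hg : LocallyLipschitz g)
    (hN : dataNorm g < ⊤) :
    IsAdmissible (fun q : ℝ × ℝ => g !₂[q.1, q.2]) (dataNorm g).toReal where
  continuous := by
    have := hg.continuous
    fun_prop
  locallyLipschitz ξ := by
    have h : ContDiff ℝ 1 (fun s : ℝ => (!₂[ξ, s] : Plane)) := by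
      rw [funext (vec_eq_add_smul ξ)]
      fun_prop
    exact hg.comp h.locallyLipschitz
  norm_le := by
    have h1 := ae_le_toReal_of_eLpNorm_le hN (self_le_add_right _ _ :
      eLpNorm (fun k : Plane => japaneseBracket ‖k‖ ^ 5 * ‖g k‖) ⊤ volume ≤ dataNorm g)
    -- The essential bound holds everywhere: the set where it holds is closed by continuity, and
    -- dense because it has full measure.
    have hcl : IsClosed {k : Plane | japaneseBracket ‖k‖ ^ 5 * ‖g k‖ ≤ (dataNorm g).toReal} := by
      have := hg.continuous
      unfold japaneseBracket
      exact isClosed_le (by fun_prop) continuous_const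
    have huniv := (Measure.dense_of_ae h1).closure_eq
    rw [hcl.closure_eq] at huniv
    intro ξ η
    have h2 : (!₂[ξ, η] : Plane) ∈
        {k : Plane | japaneseBracket ‖k‖ ^ 5 * ‖g k‖ ≤ (dataNorm g).toReal} :=
      huniv ▸ mem_univ _
    rw [mem_ofPred_eq, japaneseBracket_norm, mul_comm] at h2
    simpa using h2
  deriv_le := by
    have h1 := ae_le_toReal_of_eLpNorm_le hN (self_le_add_left _ _ :
      eLpNorm (fun k : Plane => japaneseBracket ‖k‖ ^ 6 * ‖fderiv ℝ g k‖) ⊤ volume ≤ dataNorm g)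
    refine ⟨fun ξ η => fderiv ℝ g !₂[ξ, η] (EuclideanSpace.single 1 1), ?_⟩
    -- Differentiability is needed besides the bound, since `fderiv` takes the default value 0
    -- elsewhere. Fubini then passes to almost every point of almost every line.
    have h2 := measurePreserving_planeEquiv.symm.quasiMeasurePreserving.ae
      (h1.and (ae_differentiableAt_of_locallyLipschitz hg))
    filter_upwards [Measure.ae_ae_of_ae_prod h2] with ξ hξ
    filter_upwards [hξ] with η hη
    rw [planeEquiv_symm_apply] at hη
    obtain ⟨hle, hdiff⟩ := hη
    constructor
    · have hline : HasDerivAt (fun s : ℝ => (!₂[ξ, s] : Plane))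
          (EuclideanSpace.single 1 (1 : ℝ)) η := by
        rw [funext (vec_eq_add_smul ξ)]
        simpa using ((hasDerivAt_id η).smul_const
          (EuclideanSpace.single 1 (1 : ℝ) : Plane)).const_add (!₂[ξ, 0] : Plane)
      exact hdiff.hasFDerivAt.comp_hasDerivAt η hline
    · rw [japaneseBracket_norm, mul_comm] at hle
      have hb := one_le_bracket ξ η
      have hn : ‖fderiv ℝ g !₂[ξ, η] (EuclideanSpace.single 1 1)‖ ≤ ‖fderiv ℝ g !₂[ξ, η]‖ := by
        refine (ContinuousLinearMap.le_opNorm _ _).trans (le_of_eq ?_)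
        simp
      calc _ ≤ ‖fderiv ℝ g !₂[ξ, η]‖ * bracket ξ η ^ 6 := by gcongr
        _ ≤ _ := by simpa using hle

/-! ### The stream function profile -/

theorem integrable_and_integral_of_ae_eq_density {t M : ℝ} {m : ℝ → ℝ → ℝ} (hm : IsMultiplier m)
    {G : ℝ × ℝ → ℂ} (hG : IsAdmissible G M) {φ : Plane → ℂ}
    (hφ : φ =ᵐ[volume] fun k => Complex.I * density t m G (k 0, k 1)) :
    Integrable φ (volume : Measure Plane) ∧ ∀ p : Plane, ‖planeFourierInvIntegral φ p‖ ≤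
      ‖∫ q : ℝ × ℝ, character (p 0) (p 1) q * density t m G q ∂(volume.prod volume)‖ := by
  have hmp := measurePreserving_planeEquiv
  constructor
  · refine Integrable.congr ?_ hφ.symm
    exact (hmp.integrable_comp_of_integrable (integrable_density t hm hG)).const_mul Complex.I
  · intro p
    have e : ∫ k : Plane, Complex.exp (Complex.I * ((k 0 * p 0 + k 1 * p 1 : ℝ) : ℂ)) * φ k =
        Complex.I * ∫ q : ℝ × ℝ, character (p 0) (p 1) q * density t m G q
          ∂(volume.prod volume) := by
      rw [← hmp.integral_comp planeEquiv.measurableEmbedding, ← integral_const_mul]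
      refine integral_congr_ae ?_
      filter_upwards [hφ] with k hk
      rw [hk, planeEquiv_apply]
      simp only [character]
      ring
    rw [planeFourierInvIntegral, e, norm_mul, norm_mul, Complex.norm_I, one_mul,
      Complex.norm_real, Real.norm_of_nonneg (by positivity)]
    -- The prefactor `(2π)⁻²` is at most 1 and is dropped.
    refine mul_le_of_le_one_left (norm_nonneg _) (inv_le_one_of_one_le₀ ?_)
    nlinarith [Real.pi_gt_three]

section Solution

variable {ω₀ g : Plane → ℂ} {ω : ℝ → Plane → ℂ}

theorem phiZHat_ae_eq (hg : g =ᵐ[volume] planeFourier ω₀) (hω : IsBetaPlaneSolution ω₀ ω) {t : ℝ}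
    (ht : 0 ≤ t) : phiZHat ω t =ᵐ[volume] fun k =>
      Complex.I * density t (fun ξ _ => ξ) (fun q => g !₂[q.1, q.2]) (k 0, k 1) := by
  filter_upwards [planeFourier_profile_eq hg hω ht] with k hk
  have hv : (!₂[k 0, k 1] : Plane) = k := planeEquiv.symm_apply_apply k
  simp only [phiZHat, density, hk, invSymbol, shearedSymbol, hv]
  push_cast
  ring

theorem phiYHat_ae_eq (hg : g =ᵐ[volume] planeFourier ω₀) (hω : IsBetaPlaneSolution ω₀ ω) {t : ℝ}
    (ht : 0 ≤ t) : phiYHat ω t =ᵐ[volume] fun k =>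
      Complex.I * density t (fun _ η => η) (fun q => g !₂[q.1, q.2]) (k 0, k 1) := by
  filter_upwards [planeFourier_profile_eq hg hω ht] with k hk
  have hv : (!₂[k 0, k 1] : Plane) = k := planeEquiv.symm_apply_apply k
  simp only [phiYHat, density, hk, invSymbol, shearedSymbol, hv]
  push_cast
  ring

/-- The constant in the decay estimates for the profile. -/
def decayConst : ℝ := 88 * majorantMass ^ 2 + 44 * Real.pi ^ 2 + 1

theorem decayConst_pos : 0 < decayConst := by unfold decayConst; positivity

theorem one_le_japaneseBracket (t : ℝ) : 1 ≤ japaneseBracket t :=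
  Real.one_le_sqrt.2 (by nlinarith [sq_nonneg t])

theorem japaneseBracket_le_of_one_le {t : ℝ} (ht : 1 ≤ t) : japaneseBracket t ≤ 2 * t :=
  Real.sqrt_le_iff.2 ⟨by linarith, by nlinarith⟩

theorem japaneseBracket_le_of_le_one {t : ℝ} (h0 : 0 < t) (ht : t ≤ 1) : japaneseBracket t ≤ 2 :=
  Real.sqrt_le_iff.2 ⟨by norm_num, by nlinarith⟩

theorem rpow_three_halves {s : ℝ} (hs : 0 ≤ s) : s ^ (3 / 2 : ℝ) = s * √s := by
  rw [Real.sqrt_eq_rpow, show (3 / 2 : ℝ) = 1 + 1 / 2 by norm_num,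
    Real.rpow_add_of_nonneg hs zero_le_one (by norm_num), Real.rpow_one]

theorem sqrt_four : √(4 : ℝ) = 2 := by
  rw [show (4 : ℝ) = 2 ^ 2 by norm_num]; exact Real.sqrt_sq (by norm_num)

/-- For `t ≥ 1` the oscillatory bound applies, and `⟨t⟩^{3/2} ≤ 4t^{3/2}` turns 22 into 88. For `t ≤
1` the bound without cancellation suffices, as `⟨t⟩` is at most 2. -/
theorem norm_phiZ_le (hg : g =ᵐ[volume] planeFourier ω₀) (hL : LocallyLipschitz g)
    (hN : dataNorm g < ⊤) (hω : IsBetaPlaneSolution ω₀ ω) {t : ℝ} (ht : 0 < t) (p : Plane) :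
    ‖phiZ ω t p‖ ≤ decayConst * (1 + |p 1|) * (dataNorm g).toReal *
      (japaneseBracket t ^ (3 / 2 : ℝ))⁻¹ := by
  have hG := isAdmissible_of_dataNorm hL hN
  set M := (dataNorm g).toReal
  have hM : 0 ≤ M := hG.nonneg
  have hb1 := one_le_japaneseBracket t
  refine ((integrable_and_integral_of_ae_eq_density isMultiplier_fst hG
    (phiZHat_ae_eq hg hω ht.le)).2 p).trans ?_
  have hy := abs_nonneg (p 1)
  rw [rpow_three_halves (by linarith)]
  have hC : 88 * majorantMass ^ 2 ≤ decayConst := by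
    unfold decayConst; nlinarith [sq_nonneg Real.pi]
  rcases le_total 1 t with h | h
  · refine (norm_integral_density_fst_le ht (p 0) (p 1) hG).trans ?_
    have h1 : japaneseBracket t * √(japaneseBracket t) ≤ 4 * (t * √t) := by
      have h2 : japaneseBracket t ≤ 2 * t := japaneseBracket_le_of_one_le h
      calc japaneseBracket t * √(japaneseBracket t) ≤ (2 * t) * √(4 * t) := by
            gcongr
            linarith
        _ = 4 * (t * √t) := by
            rw [Real.sqrt_mul (by norm_num), sqrt_four]; ring
    have h3 : (t * √t)⁻¹ ≤ 4 * (japaneseBracket t * √(japaneseBracket t))⁻¹ := by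
      rw [← div_eq_mul_inv, le_div_iff₀ (by positivity), inv_mul_le_iff₀ (by positivity)]
      linarith
    calc (22 + 4 * |p 1|) * M * ((t * √t)⁻¹ * majorantMass ^ 2)
        ≤ (22 * (1 + |p 1|)) * M *
            ((4 * (japaneseBracket t * √(japaneseBracket t))⁻¹) * majorantMass ^ 2) := by
          gcongr
          linarith
      _ = (88 * majorantMass ^ 2) * (1 + |p 1|) * M *
            (japaneseBracket t * √(japaneseBracket t))⁻¹ := by ring
      _ ≤ _ := by gcongr
  · refine (norm_integral_density_le t (p 0) (p 1) isMultiplier_fst hG).trans ?_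
    have h1 : japaneseBracket t * √(japaneseBracket t) ≤ 4 := by
      have h2 : japaneseBracket t ≤ 2 := japaneseBracket_le_of_le_one ht h
      calc japaneseBracket t * √(japaneseBracket t) ≤ 2 * √4 := by
            gcongr
            linarith
        _ = 4 := by rw [sqrt_four]; norm_num
    have h3 : 1 ≤ 4 * (japaneseBracket t * √(japaneseBracket t))⁻¹ := by
      rwa [← div_eq_mul_inv, le_div_iff₀ (by positivity), one_mul]
    have h4 : 2 * (1 + t ^ 2) ≤ 4 := by nlinarith
    calc 2 * (1 + t ^ 2) * M * majorantMass ^ 2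
        ≤ 4 * M * majorantMass ^ 2 * 1 := by rw [mul_one]; gcongr
      _ ≤ 4 * M * majorantMass ^ 2 * (4 * (japaneseBracket t * √(japaneseBracket t))⁻¹) := by
          gcongr
      _ = (16 * majorantMass ^ 2) * 1 * M * (japaneseBracket t * √(japaneseBracket t))⁻¹ := by
          ring
      _ ≤ _ := by
          have := decayConst_pos.le
          gcongr
          · nlinarith [sq_nonneg majorantMass]
          · linarith

theorem norm_phiY_le (hg : g =ᵐ[volume] planeFourier ω₀) (hL : LocallyLipschitz g)
    (hN : dataNorm g < ⊤) (hω : IsBetaPlaneSolution ω₀ ω) {t : ℝ} (ht : 0 < t) (p : Plane) :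
    ‖phiY ω t p‖ ≤ decayConst * (1 + |p 1|) * (dataNorm g).toReal * (japaneseBracket t)⁻¹ := by
  have hG := isAdmissible_of_dataNorm hL hN
  set M := (dataNorm g).toReal
  have hM : 0 ≤ M := hG.nonneg
  have hb1 := one_le_japaneseBracket t
  refine ((integrable_and_integral_of_ae_eq_density isMultiplier_snd hG
    (phiYHat_ae_eq hg hω ht.le)).2 p).trans ?_
  have hy := abs_nonneg (p 1)
  rcases le_total 1 t with h | h
  · refine (norm_integral_density_snd_le ht (p 0) (p 1) hG).trans ?_
    have hC : 44 * Real.pi ^ 2 ≤ decayConst := by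
      unfold decayConst; nlinarith [sq_nonneg majorantMass]
    have h3 : t⁻¹ ≤ 2 * (japaneseBracket t)⁻¹ := by
      rw [← div_eq_mul_inv, le_div_iff₀ (by positivity), inv_mul_le_iff₀ (by positivity)]
      linarith [japaneseBracket_le_of_one_le h]
    calc (22 + 4 * |p 1|) * M * (Real.pi / t * Real.pi)
        = (22 + 4 * |p 1|) * M * (t⁻¹ * Real.pi ^ 2) := by ring
      _ ≤ (22 * (1 + |p 1|)) * M * ((2 * (japaneseBracket t)⁻¹) * Real.pi ^ 2) := by
          gcongr
          linarith
      _ = (44 * Real.pi ^ 2) * (1 + |p 1|) * M * (japaneseBracket t)⁻¹ := by ring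
      _ ≤ _ := by gcongr
  · refine (norm_integral_density_le t (p 0) (p 1) isMultiplier_snd hG).trans ?_
    have h3 : 1 ≤ 2 * (japaneseBracket t)⁻¹ := by
      rw [← div_eq_mul_inv, le_div_iff₀ (by positivity), one_mul]
      exact japaneseBracket_le_of_le_one ht h
    have h4 : 2 * (1 + t ^ 2) ≤ 4 := by nlinarith
    calc 2 * (1 + t ^ 2) * M * majorantMass ^ 2
        ≤ 4 * M * majorantMass ^ 2 * 1 := by rw [mul_one]; gcongr
      _ ≤ 4 * M * majorantMass ^ 2 * (2 * (japaneseBracket t)⁻¹) := by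
          gcongr
      _ = (8 * majorantMass ^ 2) * 1 * M * (japaneseBracket t)⁻¹ := by ring
      _ ≤ _ := by
          have := decayConst_pos.le
          gcongr
          · unfold decayConst
            nlinarith [sq_nonneg majorantMass, sq_nonneg Real.pi]
          · linarith

/-! ### The velocity -/

theorem vorticityProfile_eq (ω : ℝ → Plane → ℂ) (t : ℝ) :
    vorticityProfile ω t = ω t ∘ positionShear t := rfl

theorem planeFourier_vorticity_ae_eq (hω : IsBetaPlaneSolution ω₀ ω) {t : ℝ} (ht : 0 ≤ t) :
    planeFourier (ω t) =ᵐ[volume]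
      fun k => planeFourier (vorticityProfile ω t) (frequencyShear t k) := by
  have h := planeFourier_comp_positionShear t (hω.memLp t ht)
  rw [← vorticityProfile_eq] at h
  have h2 := (measurePreserving_frequencyShear t).quasiMeasurePreserving.ae h
  filter_upwards [h2] with k hk
  rw [hk, frequencyShear_neg_frequencyShear]

theorem shearedSymbol_frequencyShear (t : ℝ) (k : Plane) :
    shearedSymbol t (frequencyShear t k) = k 0 ^ 2 + k 1 ^ 2 := by
  simp [shearedSymbol, frequencyShear]

/-- The chain rule for `ψ(x, y) = φ(x - ty, y)`, on the Fourier side: `∂_y ψ = φ_y - tφ_z`. -/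
theorem velXHat_ae_eq (hω : IsBetaPlaneSolution ω₀ ω) {t : ℝ} (ht : 0 ≤ t) :
    velXHat ω t =ᵐ[volume]
      (fun k => phiYHat ω t k - (t : ℂ) * phiZHat ω t k) ∘ frequencyShear t := by
  filter_upwards [planeFourier_vorticity_ae_eq hω ht] with k hk
  have h1 : frequencyShear t k 1 = k 1 + t * k 0 := rfl
  have h0 : frequencyShear t k 0 = k 0 := rfl
  rw [velXHat, hk, Function.comp_apply, phiYHat, phiZHat, shearedSymbol_frequencyShear, h0, h1]
  push_cast
  ring

theorem velYHat_ae_eq (hω : IsBetaPlaneSolution ω₀ ω) {t : ℝ} (ht : 0 ≤ t) :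
    velYHat ω t =ᵐ[volume] (fun k => -phiZHat ω t k) ∘ frequencyShear t := by
  filter_upwards [planeFourier_vorticity_ae_eq hω ht] with k hk
  have h0 : frequencyShear t k 0 = k 0 := rfl
  rw [velYHat, hk, Function.comp_apply, phiZHat, shearedSymbol_frequencyShear, h0]
  ring

/-- The frequency shear preserves measure, and its effect on the character moves to the position
variable as `x ↦ x - ty`. -/
theorem planeFourierInvIntegral_shear {t : ℝ} {v φ : Plane → ℂ}
    (h : v =ᵐ[volume] φ ∘ frequencyShear t) (x y : ℝ) :
    planeFourierInvIntegral v !₂[x, y] = planeFourierInvIntegral φ !₂[x - t * y, y] := by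
  unfold planeFourierInvIntegral
  congr 1
  rw [← (measurePreserving_frequencyShear t).integral_comp (measurableEmbedding_frequencyShear t)
    (fun l => Complex.exp (Complex.I * ((l 0 * (!₂[x - t * y, y] : Plane) 0 +
      l 1 * (!₂[x - t * y, y] : Plane) 1 : ℝ) : ℂ)) * φ l)]
  refine integral_congr_ae ?_
  filter_upwards [h] with k hk
  rw [hk]
  simp only [frequencyShear, Function.comp_apply, PiLp.toLp_apply, Matrix.cons_val_zero,
    Matrix.cons_val_one]
  congr 3
  push_cast
  ring

theorem integrable_exp_mul {φ : Plane → ℂ} (h : Integrable φ (volume : Measure Plane)) (p : Plane) :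
    Integrable (fun k : Plane =>
      Complex.exp (Complex.I * ((k 0 * p 0 + k 1 * p 1 : ℝ) : ℂ)) * φ k) volume :=
  h.bdd_mul (c := 1) (by
    have : Continuous fun k : Plane =>
      Complex.exp (Complex.I * ((k 0 * p 0 + k 1 * p 1 : ℝ) : ℂ)) := by fun_prop
    exact this.aestronglyMeasurable) (ae_of_all _ fun k => (norm_exp_I_mul _).le)

theorem velX_eq (hω : IsBetaPlaneSolution ω₀ ω) {t : ℝ} (ht : 0 ≤ t)
    (hY : Integrable (phiYHat ω t) (volume : Measure Plane))
    (hZ : Integrable (phiZHat ω t) (volume : Measure Plane)) (x y : ℝ) :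
    velX ω t !₂[x, y] = phiY ω t !₂[x - t * y, y] - (t : ℂ) * phiZ ω t !₂[x - t * y, y] := by
  rw [velX, planeFourierInvIntegral_shear (velXHat_ae_eq hω ht), phiY, phiZ]
  generalize (!₂[x - t * y, y] : Plane) = p
  unfold planeFourierInvIntegral
  have e : ∀ k : Plane, ∀ c : ℂ, c * (phiYHat ω t k - (t : ℂ) * phiZHat ω t k) =
      c * phiYHat ω t k - (t : ℂ) * (c * phiZHat ω t k) := fun k c => by ring
  simp_rw [e]
  rw [integral_sub (integrable_exp_mul hY _) ((integrable_exp_mul hZ _).const_mul _),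
    integral_const_mul]
  ring

theorem velY_eq (hω : IsBetaPlaneSolution ω₀ ω) {t : ℝ} (ht : 0 ≤ t) (x y : ℝ) :
    velY ω t !₂[x, y] = -phiZ ω t !₂[x - t * y, y] := by
  rw [velY, planeFourierInvIntegral_shear (velYHat_ae_eq hω ht), phiZ]
  unfold planeFourierInvIntegral
  simp_rw [mul_neg, integral_neg, mul_neg]

theorem integrable_phiHat (hg : g =ᵐ[volume] planeFourier ω₀) (hL : LocallyLipschitz g)
    (hN : dataNorm g < ⊤) (hω : IsBetaPlaneSolution ω₀ ω) {t : ℝ} (ht : 0 ≤ t) :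
    Integrable (phiZHat ω t) (volume : Measure Plane) ∧
      Integrable (phiYHat ω t) (volume : Measure Plane) :=
  have hG := isAdmissible_of_dataNorm hL hN
  ⟨(integrable_and_integral_of_ae_eq_density isMultiplier_fst hG (phiZHat_ae_eq hg hω ht)).1,
    (integrable_and_integral_of_ae_eq_density isMultiplier_snd hG (phiYHat_ae_eq hg hω ht)).1⟩

theorem integrable_velHat (hg : g =ᵐ[volume] planeFourier ω₀) (hL : LocallyLipschitz g)
    (hN : dataNorm g < ⊤) (hω : IsBetaPlaneSolution ω₀ ω) {t : ℝ} (ht : 0 ≤ t) :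
    Integrable (velXHat ω t) (volume : Measure Plane) ∧
      Integrable (velYHat ω t) (volume : Measure Plane) := by
  obtain ⟨hZ, hY⟩ := integrable_phiHat hg hL hN hω ht
  have hmp := measurePreserving_frequencyShear t
  exact ⟨(hmp.integrable_comp_of_integrable (hY.sub (hZ.const_mul (t : ℂ)))).congr
    (velXHat_ae_eq hω ht).symm,
    (hmp.integrable_comp_of_integrable hZ.neg).congr (velYHat_ae_eq hω ht).symm⟩

end Solution

/-! ### Comparison with the weights of the statement -/

theorem half_le_log {s : ℝ} (hs : 2 ≤ s) : 1 / 2 ≤ Real.log s := by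
  have h := Real.log_le_log (by norm_num) hs
  linarith [Real.log_two_gt_d9]

/-- Since `ρ` or `ρ⁻¹` is at least 1, the logarithm is at least `log 2 ≥ 1/2`; the linear growth in
`y` is absorbed by `⟨ρ⟩`. -/
theorem one_add_abs_le {p : Plane} (hp : p ≠ 0) :
    1 + |p 1| ≤ 4 * (japaneseBracket ‖p‖ * Real.log (‖p‖ + ‖p‖⁻¹ + 1)) := by
  have hpos : 0 < ‖p‖ := norm_pos_iff.2 hp
  have h1 : 1 / 2 ≤ Real.log (‖p‖ + ‖p‖⁻¹ + 1) := by
    refine half_le_log ?_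
    rcases le_total 1 ‖p‖ with h | h
    · have : 0 < ‖p‖⁻¹ := by positivity
      linarith
    · have := (one_le_inv₀ hpos).2 h
      linarith
  have h2 : |p 1| ≤ japaneseBracket ‖p‖ := by
    rw [japaneseBracket_norm]; exact abs_le_bracket _ _
  have h3 := one_le_japaneseBracket ‖p‖
  nlinarith

theorem mul_inv_rpow_three_halves_le (t : ℝ) :
    t * (japaneseBracket t ^ (3 / 2 : ℝ))⁻¹ ≤ japaneseBracket t ^ (-(1 / 2) : ℝ) := by
  have hb := one_le_japaneseBracket t
  have hb0 : 0 < japaneseBracket t := by linarith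
  have h1 : t ≤ japaneseBracket t :=
    (le_abs_self t).trans (Real.abs_le_sqrt (by linarith))
  calc t * (japaneseBracket t ^ (3 / 2 : ℝ))⁻¹
      ≤ japaneseBracket t ^ (1 : ℝ) * (japaneseBracket t ^ (3 / 2 : ℝ))⁻¹ := by
        rw [Real.rpow_one]; gcongr
    _ = japaneseBracket t ^ (-(1 / 2) : ℝ) := by
        rw [← Real.rpow_neg hb0.le, ← Real.rpow_add hb0]; norm_num

end

end BetaPlane

open BetaPlane in
theorem theorem1 :
    -- pointwise decay of the gradient of the stream function profile
    (∃ C : ℝ, 0 < C ∧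
      ∀ (ω₀ g : Plane → ℂ) (ω : ℝ → Plane → ℂ),
        MemLp ω₀ 2 (volume : Measure Plane) →
        g =ᵐ[volume] planeFourier ω₀ → LocallyLipschitz g → dataNorm g < ⊤ →
        IsBetaPlaneSolution ω₀ ω →
        ∀ t : ℝ, 0 < t →
          Integrable (phiZHat ω t) (volume : Measure Plane) ∧
          Integrable (phiYHat ω t) (volume : Measure Plane) ∧
          ∀ p : Plane, p ≠ 0 →
            ‖phiZ ω t p‖ ≤ C * (dataNorm g).toReal *
              (japaneseBracket ‖p‖ * Real.log (‖p‖ + ‖p‖⁻¹ + 1)) *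
              (Real.log (t + 2) / japaneseBracket t ^ (3 / 2 : ℝ)) ∧
            ‖phiY ω t p‖ ≤ C * (dataNorm g).toReal *
              (japaneseBracket ‖p‖ * Real.log (‖p‖ + ‖p‖⁻¹ + 1)) *
              (Real.log (t + 2) / japaneseBracket t)) ∧
    -- pointwise decay of the velocity in the original variables
    (∀ R : ℝ, 0 < R → ∃ C : ℝ, 0 < C ∧
      ∀ (ω₀ g : Plane → ℂ) (ω : ℝ → Plane → ℂ),
        MemLp ω₀ 2 (volume : Measure Plane) →
        g =ᵐ[volume] planeFourier ω₀ → LocallyLipschitz g → dataNorm g < ⊤ →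
        IsBetaPlaneSolution ω₀ ω →
        ∀ t : ℝ, 0 < t →
          Integrable (velXHat ω t) (volume : Measure Plane) ∧
          Integrable (velYHat ω t) (volume : Measure Plane) ∧
          ∀ x y : ℝ, 1 / R ≤ |x - t * y| + |y| → |x - t * y| + |y| ≤ R →
            ‖velX ω t !₂[x, y]‖ ≤ C * (dataNorm g).toReal *
              (Real.log (t + 2) * japaneseBracket t ^ (-(1 / 2) : ℝ)) ∧
            ‖velY ω t !₂[x, y]‖ ≤ C * (dataNorm g).toReal *
              (Real.log (t + 2) * japaneseBracket t ^ (-(3 / 2) : ℝ))) := by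
  have hD := decayConst_pos
  constructor
  · refine ⟨8 * decayConst, by positivity, fun ω₀ g ω _ hg hL hN hω t ht => ?_⟩
    obtain ⟨hZ, hY⟩ := integrable_phiHat hg hL hN hω ht.le
    refine ⟨hZ, hY, fun p hp => ?_⟩
    have hlog : 1 / 2 ≤ Real.log (t + 2) := half_le_log (by linarith)
    have hb := one_le_japaneseBracket t
    have hM : 0 ≤ (dataNorm g).toReal := ENNReal.toReal_nonneg
    have hp1 := one_add_abs_le hp
    set A := japaneseBracket ‖p‖ * Real.log (‖p‖ + ‖p‖⁻¹ + 1)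
    have hA : 0 ≤ A := by linarith [abs_nonneg (p 1)]
    have main : ∀ s : ℝ, 0 ≤ s → decayConst * (1 + |p 1|) * (dataNorm g).toReal * s ≤
        8 * decayConst * (dataNorm g).toReal * A * (Real.log (t + 2) * s) := by
      intro s hs
      calc decayConst * (1 + |p 1|) * (dataNorm g).toReal * s
          ≤ decayConst * (4 * A) * (dataNorm g).toReal * s := by gcongr
        _ = 8 * decayConst * (dataNorm g).toReal * A * (1 / 2 * s) := by ring
        _ ≤ _ := by gcongr
    rw [div_eq_mul_inv, div_eq_mul_inv]
    exact ⟨(norm_phiZ_le hg hL hN hω ht p).trans (main _ (by positivity)),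
      (norm_phiY_le hg hL hN hω ht p).trans (main _ (by positivity))⟩
  · intro R hR
    -- One factor 2 accounts for the two terms of `u^x`, the other for `log(t + 2) ≥ 1/2`; `1 + R`
    -- bounds `1 + |y|`.
    refine ⟨4 * decayConst * (1 + R), by positivity, fun ω₀ g ω _ hg hL hN hω t ht => ?_⟩
    obtain ⟨hZ, hY⟩ := integrable_phiHat hg hL hN hω ht.le
    obtain ⟨hU, hV⟩ := integrable_velHat hg hL hN hω ht.le
    refine ⟨hU, hV, fun x y _ hxy => ?_⟩
    have hlog : 1 / 2 ≤ Real.log (t + 2) := half_le_log (by linarith)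
    have hb := one_le_japaneseBracket t
    have hb0 : 0 < japaneseBracket t := by linarith
    have hM : 0 ≤ (dataNorm g).toReal := ENNReal.toReal_nonneg
    have hy : |y| ≤ R := by linarith [abs_nonneg (x - t * y)]
    have eZ : ‖phiZ ω t !₂[x - t * y, y]‖ ≤ decayConst * (1 + |y|) * (dataNorm g).toReal *
      (japaneseBracket t ^ (3 / 2 : ℝ))⁻¹ := norm_phiZ_le hg hL hN hω ht !₂[x - t * y, y]
    have eY : ‖phiY ω t !₂[x - t * y, y]‖ ≤ decayConst * (1 + |y|) * (dataNorm g).toReal *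
      (japaneseBracket t)⁻¹ := norm_phiY_le hg hL hN hω ht !₂[x - t * y, y]
    have main : ∀ s : ℝ, 0 ≤ s → decayConst * (1 + |y|) * (dataNorm g).toReal * (2 * s) ≤
        4 * decayConst * (1 + R) * (dataNorm g).toReal * (Real.log (t + 2) * s) := by
      intro s hs
      calc decayConst * (1 + |y|) * (dataNorm g).toReal * (2 * s)
          ≤ decayConst * (1 + R) * (dataNorm g).toReal * (2 * s) := by gcongr
        _ = 4 * decayConst * (1 + R) * (dataNorm g).toReal * (1 / 2 * s) := by ring
        _ ≤ _ := by gcongr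
    constructor
    · rw [velX_eq hω ht.le hY hZ]
      have h1 : (japaneseBracket t)⁻¹ ≤ japaneseBracket t ^ (-(1 / 2) : ℝ) := by
        rw [← Real.rpow_neg_one]
        exact Real.rpow_le_rpow_of_exponent_le hb (by norm_num)
      have h2 := mul_inv_rpow_three_halves_le t
      refine le_trans ?_ (main _ (by positivity))
      refine (norm_sub_le _ _).trans ?_
      rw [norm_mul, Complex.norm_real, Real.norm_of_nonneg ht.le]
      calc ‖phiY ω t !₂[x - t * y, y]‖ + t * ‖phiZ ω t !₂[x - t * y, y]‖
          ≤ decayConst * (1 + |y|) * (dataNorm g).toReal * (japaneseBracket t)⁻¹ +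
            t * (decayConst * (1 + |y|) * (dataNorm g).toReal *
              (japaneseBracket t ^ (3 / 2 : ℝ))⁻¹) := by gcongr
        _ = decayConst * (1 + |y|) * (dataNorm g).toReal * ((japaneseBracket t)⁻¹ +
              t * (japaneseBracket t ^ (3 / 2 : ℝ))⁻¹) := by ring
        _ ≤ _ := by
            gcongr
            linarith
    · rw [velY_eq hω ht.le, norm_neg, Real.rpow_neg hb0.le]
      refine eZ.trans (le_trans ?_ (main _ (by positivity)))
      gcongr
      have : 0 ≤ (japaneseBracket t ^ (3 / 2 : ℝ))⁻¹ := by positivity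
      linarith
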